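/- Conventions. Let $\beta=r/s>1$ be a rational number, with integers $r>s>0$ and $\gcd(r,s)=1$, and let $d\ge 1$ be an integer. A polynomial $F\in\mathbb R[X,Y]$ is $\beta$-quasihomogeneous of degree $d$ if $F(tx,t^\beta y)=t^dF(x,y)$ for all $t>0$ and $x,y\in\mathbb R$; its height functions are $f_+(t)=F(1,t)$ and $f_-(t)=F(-1,t)$. A proto-transition is a pair $(\lambda,\phi)=((\lambda_1,\lambda_2),(\phi_1,\phi_2))$, where $\lambda_1,\lambda_2$ are real numbers with $\lambda_1\lambda_2>0$ and $\phi_1,\phi_2:\mathbb R\to\mathbb R$ are bi-Lipschitz Nash diffeomorphisms (bijections that are, together with their inverses, smooth, semialgebraic and Lipschitz). For functions $g_1,g_2:\mathbb R\to\mathbb R$ put $$(g_1,g_2)\circ(\lambda,\phi)=\begin{cases}\left(|\lambda_1|^d\,g_1\circ\phi_1,\ |\lambda_2|^d\,g_2\circ\phi_2\right)&\text{if }\lambda_1,\lambda_2>0,\\ \left(|\lambda_1|^d\,g_2\circ\phi_1,\ |\lambda_2|^d\,g_1\circ\phi_2\right)&\text{if }\lambda_1,\lambda_2<0.\end{cases}$$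 Two $\beta$-quasihomogeneous polynomials $F,G$ of degree $d$ are $\mathcal R$-semialgebraically Lipschitz equivalent if there is a germ $\Phi:(\mathbb R^2,0)\to(\mathbb R^2,0)$ of semialgebraic bi-Lipschitz homeomorphism such that $G\circ\Phi=F$ as germs at the origin. Theorem. Let $F,G\in\mathbb R[X,Y]$ be $\beta$-quasihomogeneous polynomials of degree $d\ge 1$, neither of which is of the form $cX^d$ with $c\in\mathbb R$. Let $f_+,f_-$ be the height functions of $F$ and $g_+,g_-$ those of $G$. Suppose that $(g_+,g_-)\circ(\lambda,\phi)=(f_+,f_-)$ for some proto-transition $(\lambda,\phi)$. If any of the following conditions holds, then $F$ and $G$ are $\mathcal R$-semialgebraically Lipschitz equivalent: (a) $r$ is even or $s$ is odd; (b) $\lambda_1=\lambda_2$; (c) neither $F$ nor $G$ has $X$ as a factor. -/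

import Mathlib

open Topology
open scoped ContDiff

noncomputable section

namespace SemialgLip

/-- Semialgebraic subsets of `ℝ^ι`: the smallest family of subsets that contains all sets
`{p > 0}` with `p` a real polynomial and is closed under complements and finite unions. -/
inductive IsSemialgebraic {ι : Type} : Set (ι → ℝ) → Prop
  | pos (p : MvPolynomial ι ℝ) : IsSemialgebraic {v | 0 < MvPolynomial.eval v p}
  | compl {A : Set (ι → ℝ)} : IsSemialgebraic A → IsSemialgebraic Aᶜ
  | union {A B : Set (ι → ℝ)} :
      IsSemialgebraic A → IsSemialgebraic B → IsSemialgebraic (A ∪ B)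

/-- A function `ℝ → ℝ` is semialgebraic if its graph is a semialgebraic subset of `ℝ²`. -/
def IsSemialgebraicFun (φ : ℝ → ℝ) : Prop :=
  IsSemialgebraic {v : Fin 2 → ℝ | v 1 = φ (v 0)}

/-- A subset of the plane `ℝ × ℝ` is semialgebraic. -/
def IsSemialgebraicPlane (U : Set (ℝ × ℝ)) : Prop :=
  IsSemialgebraic {v : Fin 2 → ℝ | (v 0, v 1) ∈ U}

/-- The restriction of `Φ` to the set `U` of the plane has a semialgebraic graph in `ℝ⁴`. -/
def HasSemialgebraicGraphOn (Φ : ℝ × ℝ → ℝ × ℝ) (U : Set (ℝ × ℝ)) : Prop :=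
  IsSemialgebraic {v : Fin 4 → ℝ | (v 0, v 1) ∈ U ∧ (v 2, v 3) = Φ (v 0, v 1)}

/-- The value `F(x, y)` of a real polynomial in the two variables `X = X 0` and `Y = X 1`. -/
def evalAt (F : MvPolynomial (Fin 2) ℝ) (x y : ℝ) : ℝ :=
  MvPolynomial.eval ![x, y] F

/-- `F` is `β`-quasihomogeneous of degree `d`: `F(t x, t^β y) = t^d F(x, y)` for all `t > 0`. -/
def IsQuasihomogeneous (β : ℚ) (d : ℕ) (F : MvPolynomial (Fin 2) ℝ) : Prop :=
  ∀ t : ℝ, 0 < t → ∀ x y : ℝ,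
    evalAt F (t * x) (t ^ (β : ℝ) * y) = t ^ d * evalAt F x y

/-- The right height function `f₊(t) = F(1, t)`. -/
def rightHeight (F : MvPolynomial (Fin 2) ℝ) (t : ℝ) : ℝ := evalAt F 1 t

/-- The left height function `f₋(t) = F(-1, t)`. -/
def leftHeight (F : MvPolynomial (Fin 2) ℝ) (t : ℝ) : ℝ := evalAt F (-1) t

/-- Bi-Lipschitz Nash diffeomorphisms of `ℝ`: bijections that are, together with their inverse,
smooth, semialgebraic and Lipschitz. -/
structure IsBiLipschitzNash (φ : ℝ ≃ ℝ) : Prop where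
  contDiff : ContDiff ℝ ∞ φ
  contDiff_symm : ContDiff ℝ ∞ φ.symm
  semialgebraic : IsSemialgebraicFun φ
  semialgebraic_symm : IsSemialgebraicFun φ.symm
  lipschitz : ∃ K, LipschitzWith K φ
  lipschitz_symm : ∃ K, LipschitzWith K φ.symm

/-- A proto-transition `(λ, φ) = ((λ₁, λ₂), (φ₁, φ₂))`: two nonzero real numbers of the same sign
and two bi-Lipschitz Nash diffeomorphisms of the line. -/
structure ProtoTransition where
  lam₁ : ℝ
  lam₂ : ℝ
  mul_pos : 0 < lam₁ * lam₂
  phi₁ : ℝ ≃ ℝ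
  phi₂ : ℝ ≃ ℝ
  nash₁ : IsBiLipschitzNash phi₁
  nash₂ : IsBiLipschitzNash phi₂

/-- The action `(g₁, g₂) ∘ (λ, φ)` in degree `d`: it is `(|λ₁|^d g₁ ∘ φ₁, |λ₂|^d g₂ ∘ φ₂)` if
`λ > 0`, and `(|λ₁|^d g₂ ∘ φ₁, |λ₂|^d g₁ ∘ φ₂)` if `λ < 0`. -/
def ProtoTransition.act (d : ℕ) (g : (ℝ → ℝ) × (ℝ → ℝ)) (T : ProtoTransition) :
    (ℝ → ℝ) × (ℝ → ℝ) :=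
  if 0 < T.lam₁ ∧ 0 < T.lam₂ then
    (fun t => |T.lam₁| ^ d * g.1 (T.phi₁ t), fun t => |T.lam₂| ^ d * g.2 (T.phi₂ t))
  else
    (fun t => |T.lam₁| ^ d * g.2 (T.phi₁ t), fun t => |T.lam₂| ^ d * g.1 (T.phi₂ t))

/-- `Φ` represents a germ `(ℝ², 0) → (ℝ², 0)` of semialgebraic bi-Lipschitz homeomorphism: it is a
homeomorphism between open semialgebraic neighbourhoods of the origin, fixes the origin, has a
semialgebraic graph, and is Lipschitz together with its inverse. (Being Lipschitz does not
depend on the choice of the norm on the plane.) -/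
structure IsSemialgebraicBiLipschitzGerm
    (Φ : OpenPartialHomeomorph (ℝ × ℝ) (ℝ × ℝ)) : Prop where
  zero_mem : (0 : ℝ × ℝ) ∈ Φ.source
  map_zero : Φ 0 = 0
  semialgebraic_source : IsSemialgebraicPlane Φ.source
  semialgebraic_target : IsSemialgebraicPlane Φ.target
  semialgebraic_graph : HasSemialgebraicGraphOn Φ Φ.source
  lipschitz : ∃ K, LipschitzOnWith K Φ Φ.source
  lipschitz_symm : ∃ K, LipschitzOnWith K Φ.symm Φ.target

/-- `F` and `G` are `R`-semialgebraically Lipschitz equivalent: `G ∘ Φ = F` as germs at the origin,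
for some germ `Φ` of semialgebraic bi-Lipschitz homeomorphism. -/
def RSemialgLipschitzEquivalent (F G : MvPolynomial (Fin 2) ℝ) : Prop :=
  ∃ Φ : OpenPartialHomeomorph (ℝ × ℝ) (ℝ × ℝ), IsSemialgebraicBiLipschitzGerm Φ ∧
    ∀ᶠ p in 𝓝 (0 : ℝ × ℝ), evalAt G (Φ p).1 (Φ p).2 = evalAt F p.1 p.2

end SemialgLip

end

/-! Quasihomogeneity means that `F` is recovered on each open half-plane from one height function:
F(x,y) = |x|^d f(y/|x|^β), where f is `heightPoly 1 F` or `heightPoly (-1) F`. If a^d g∘φ = f with a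
> 0, then the map (x,y) ↦ (ax, a^β |x|^β φ(y/|x|^β)) carries `F` to `G` on that half-plane. After
reflections that make φ increasing and send each half-plane to itself, two such maps are to be glued
along the axis x = 0.

Everything depends on φ near infinity, where the polynomial identity c·g∘φ = f controls it. It
forces g and f to have the same degree m, φ(t)/t to tend to the explicit limit `endSlope`, and the
tangent intercepts φ(t) - tφ'(t) to be bounded. The limit L extends the half-plane map to the axis
by y ↦ a^β L y. The intercept is the u-derivative of uφ(y/u), so its boundedness makes that function
Lipschitz up to u = 0; together with β ≥ 1 this makes the half-plane map Lipschitz on vertical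
strips. The same applies to the inverse.

The halves agree on the axis when a₁^β L₁ = a₂^β L₂. The two height functions of a quasihomogeneous
polynomial have coefficients of equal absolute value, so this holds if a₁ = a₂. It also holds if X
does not divide `F`: then βm = d and a^β L does not depend on a (`rpow_mul_endSlope`). If s is odd,
each left height function is, up to sign, the right one at ±t, so φ₁ yields a left-hand map with the
same a.

The graph is semialgebraic because φ(t) is the solution h of c g(h) = f(t) singled out by its
position among the finitely many critical points of g (`IsMonoBiLipschitz.eq_iff`). -/

namespace SemialgLip

/-! ### Closure properties of semialgebraic sets. -/

section Semialgebraic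

variable {ι κ : Type}

theorem IsSemialgebraic.inter {A B : Set (ι → ℝ)} (hA : IsSemialgebraic A)
    (hB : IsSemialgebraic B) : IsSemialgebraic (A ∩ B) := by
  have := (hA.compl.union hB.compl).compl
  rwa [Set.compl_union, compl_compl, compl_compl] at this

theorem IsSemialgebraic.setOf_and {p q : (ι → ℝ) → Prop} (hp : IsSemialgebraic {v | p v})
    (hq : IsSemialgebraic {v | q v}) : IsSemialgebraic {v | p v ∧ q v} := hp.inter hq

theorem IsSemialgebraic.setOf_or {p q : (ι → ℝ) → Prop} (hp : IsSemialgebraic {v | p v})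
    (hq : IsSemialgebraic {v | q v}) : IsSemialgebraic {v | p v ∨ q v} := hp.union hq

theorem IsSemialgebraic.setOf_not {p : (ι → ℝ) → Prop} (hp : IsSemialgebraic {v | p v}) :
    IsSemialgebraic {v | ¬ p v} := hp.compl

theorem IsSemialgebraic.setOf_imp {p q : (ι → ℝ) → Prop} (hp : IsSemialgebraic {v | p v})
    (hq : IsSemialgebraic {v | q v}) : IsSemialgebraic {v | p v → q v} := by
  simpa only [imp_iff_not_or] using hp.setOf_not.setOf_or hq

theorem IsSemialgebraic.setOf_iff {p q : (ι → ℝ) → Prop} (hp : IsSemialgebraic {v | p v})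
    (hq : IsSemialgebraic {v | q v}) : IsSemialgebraic {v | p v ↔ q v} := by
  simpa only [iff_iff_implies_and_implies] using
    (hp.setOf_imp hq).setOf_and (hq.setOf_imp hp)

theorem IsSemialgebraic.setOf_lt (p q : MvPolynomial ι ℝ) :
    IsSemialgebraic {v | MvPolynomial.eval v p < MvPolynomial.eval v q} := by
  simpa using IsSemialgebraic.pos (q - p)

theorem IsSemialgebraic.setOf_le (p q : MvPolynomial ι ℝ) :
    IsSemialgebraic {v | MvPolynomial.eval v p ≤ MvPolynomial.eval v q} := by
  simpa using (IsSemialgebraic.setOf_lt q p).setOf_not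

theorem IsSemialgebraic.setOf_eq (p q : MvPolynomial ι ℝ) :
    IsSemialgebraic {v | MvPolynomial.eval v p = MvPolynomial.eval v q} := by
  simpa only [le_antisymm_iff] using
    (IsSemialgebraic.setOf_le p q).setOf_and (IsSemialgebraic.setOf_le q p)

theorem IsSemialgebraic.setOf_true : IsSemialgebraic {_v : ι → ℝ | True} := by
  simpa using IsSemialgebraic.setOf_eq (0 : MvPolynomial ι ℝ) 0

theorem IsSemialgebraic.setOf_forall_mem {α : Type*} (S : Finset α) {p : α → (ι → ℝ) → Prop}
    (hp : ∀ a ∈ S, IsSemialgebraic {v | p a v}) : IsSemialgebraic {v | ∀ a ∈ S, p a v} := by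
  classical
  induction S using Finset.induction_on with
  | empty => simpa using IsSemialgebraic.setOf_true (ι := ι)
  | insert a S _ ih =>
    simp only [Finset.forall_mem_insert]
    exact (hp a (by simp)).setOf_and (ih fun b hb => hp b (by simp [hb]))

/-- Preimages of semialgebraic sets under polynomial maps are semialgebraic. -/
theorem IsSemialgebraic.preimage {A : Set (ι → ℝ)} (hA : IsSemialgebraic A)
    (q : ι → MvPolynomial κ ℝ) :
    IsSemialgebraic {v : κ → ℝ | (fun i => MvPolynomial.eval v (q i)) ∈ A} := by
  induction hA with
  | pos p =>
    have := IsSemialgebraic.pos (MvPolynomial.bind₁ q p)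
    convert this using 3 with v
    simp only [← MvPolynomial.aeval_eq_eval, MvPolynomial.aeval_bind₁]
    rfl
  | compl _ ih => exact ih.compl
  | union _ _ ih₁ ih₂ => exact ih₁.union ih₂

/-- The region above a branch `y = e * x ^ (r / s)`, `x > 0`, is semialgebraic. -/
theorem IsSemialgebraic.setOf_mul_rpow_lt {r s : ℕ} (hs : 0 < s) (e : ℝ)
    (p q : MvPolynomial ι ℝ) :
    IsSemialgebraic {v | 0 < MvPolynomial.eval v p ∧
      e * MvPolynomial.eval v p ^ ((r : ℝ) / s) < MvPolynomial.eval v q} := by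
  have hpow : ∀ x : ℝ, 0 < x → (x ^ ((r : ℝ) / s)) ^ s = x ^ r := fun x hx => by
    rw [← Real.rpow_natCast, ← Real.rpow_mul hx.le,
      div_mul_cancel₀ _ (by exact_mod_cast hs.ne'), Real.rpow_natCast]
  have key : ∀ (c : ℝ), 0 ≤ c → ∀ x z : ℝ, 0 < x →
      (c * x ^ ((r : ℝ) / s) < z ↔ 0 < z ∧ c ^ s * x ^ r < z ^ s) := fun c hc x z hx => by
    have h0 : 0 ≤ c * x ^ ((r : ℝ) / s) := by positivity
    rw [← hpow x hx, ← mul_pow]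
    constructor
    · intro h
      exact ⟨h0.trans_lt h, pow_lt_pow_left₀ h h0 hs.ne'⟩
    · rintro ⟨hz, h⟩
      exact lt_of_pow_lt_pow_left₀ s hz.le h
  have key' : ∀ (c : ℝ), 0 < c → ∀ x z : ℝ, 0 < x →
      (c * x ^ ((r : ℝ) / s) ≤ z ↔ 0 < z ∧ c ^ s * x ^ r ≤ z ^ s) := fun c hc x z hx => by
    have h0 : 0 < c * x ^ ((r : ℝ) / s) := by positivity
    rw [← hpow x hx, ← mul_pow]
    constructor
    · intro h
      exact ⟨h0.trans_le h, pow_le_pow_left₀ h0.le h s⟩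
    · rintro ⟨hz, h⟩
      exact le_of_pow_le_pow_left₀ hs.ne' hz.le h
  -- For e ≥ 0, taking s-th powers gives polynomial inequalities. For e < 0 the region is, inside p
  -- > 0, the complement of (-e) p^(r/s) ≤ -q, hence the non-strict variant `key'`.
  rcases le_or_gt 0 e with he | he
  · have h1 := (IsSemialgebraic.pos p).setOf_and ((IsSemialgebraic.pos q).setOf_and
      (IsSemialgebraic.setOf_lt (MvPolynomial.C (e ^ s) * p ^ r) (q ^ s)))
    convert h1 using 3 with v
    refine and_congr_right fun hv => ?_
    simpa using key e he _ _ hv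
  · have h1 := (IsSemialgebraic.pos p).setOf_and ((IsSemialgebraic.pos (-q)).setOf_and
      (IsSemialgebraic.setOf_le (MvPolynomial.C ((-e) ^ s) * p ^ r) ((-q) ^ s))).setOf_not
    convert h1 using 3 with v
    refine and_congr_right fun hv => ?_
    have := key' (-e) (by linarith) _ (-(MvPolynomial.eval v q)) hv
    simp only [map_neg, map_mul, map_pow, MvPolynomial.eval_C]
    rw [← this, not_le]
    constructor <;> intro h <;> linarith

end Semialgebraic

/-! ### Behaviour at infinity of a diffeomorphism intertwining two polynomials. -/

section EndBehaviour

open Filter Asymptotics Bornology Polynomial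

/-- Increasing bi-Lipschitz `C¹` diffeomorphisms of the line. -/
structure IsMonoBiLipschitz (φ : ℝ ≃ ℝ) : Prop where
  strictMono : StrictMono φ
  contDiff : ContDiff ℝ 1 φ
  contDiff_symm : ContDiff ℝ 1 φ.symm
  lipschitz : ∃ K, LipschitzWith K φ
  lipschitz_symm : ∃ K, LipschitzWith K φ.symm

variable {φ : ℝ ≃ ℝ}

theorem IsMonoBiLipschitz.symm (h : IsMonoBiLipschitz φ) : IsMonoBiLipschitz φ.symm where
  strictMono := fun a b hab => by
    rw [← h.strictMono.lt_iff_lt]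
    simpa using hab
  contDiff := h.contDiff_symm
  contDiff_symm := h.contDiff
  lipschitz := h.lipschitz_symm
  lipschitz_symm := h.lipschitz

theorem IsMonoBiLipschitz.tendsto_cobounded (h : IsMonoBiLipschitz φ) :
    Tendsto φ (cobounded ℝ) (cobounded ℝ) := by
  obtain ⟨K, hK⟩ := h.lipschitz_symm
  exact (hK.to_rightInverse φ.left_inv).tendsto_cobounded

theorem isBigO_id_of_lipschitzWith {f : ℝ → ℝ} {K : NNReal} (hK : LipschitzWith K f) :
    f =O[cobounded ℝ] (fun t : ℝ => t) := by
  have h1 : (fun t => f t - f 0) =O[cobounded ℝ] (fun t : ℝ => t) := by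
    refine IsBigO.of_bound K (Eventually.of_forall fun t => ?_)
    simpa [Real.dist_eq] using hK.dist_le_mul t 0
  have h2 : (fun _ : ℝ => f 0) =O[cobounded ℝ] (fun t : ℝ => t) := by
    have := isBigO_pow_pow_cobounded_of_le (R := ℝ) (zero_le_one)
    simp only [pow_zero, pow_one] at this
    exact (isBigO_const_const (f 0) one_ne_zero _).trans this
  simpa using h1.add h2

theorem IsMonoBiLipschitz.isTheta_id (h : IsMonoBiLipschitz φ) :
    φ =Θ[cobounded ℝ] (fun t : ℝ => t) := by
  obtain ⟨K, hK⟩ := h.lipschitz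
  obtain ⟨K', hK'⟩ := h.lipschitz_symm
  refine ⟨isBigO_id_of_lipschitzWith hK, ?_⟩
  have := (isBigO_id_of_lipschitzWith hK').comp_tendsto h.tendsto_cobounded
  simpa [Function.comp_def] using this

theorem isTheta_eval_cobounded {P : ℝ[X]} (hP : P ≠ 0) :
    (fun t => P.eval t) =Θ[cobounded ℝ] (fun t => t ^ P.natDegree) :=
  (isEquivalent_cobounded_leading_monomial (P := P)).isTheta.trans
    ((isTheta_const_mul_left (leadingCoeff_ne_zero.mpr hP)).mpr (isTheta_refl _ _))

theorem IsMonoBiLipschitz.isTheta_eval_comp (h : IsMonoBiLipschitz φ) {P : ℝ[X]} (hP : P ≠ 0) :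
    (fun t => P.eval (φ t)) =Θ[cobounded ℝ] (fun t => t ^ P.natDegree) := by
  have h1 : (fun t => P.eval (φ t)) =Θ[cobounded ℝ] (fun t => φ t ^ P.natDegree) :=
    ⟨(isTheta_eval_cobounded hP).1.comp_tendsto h.tendsto_cobounded,
      (isTheta_eval_cobounded hP).2.comp_tendsto h.tendsto_cobounded⟩
  exact h1.trans (h.isTheta_id.pow _)

theorem eq_of_pow_isTheta_pow {m n : ℕ}
    (h : (fun t : ℝ => t ^ m) =Θ[cobounded ℝ] (fun t => t ^ n)) : m = n := by
  have key : ∀ {a b : ℕ}, a < b →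
      ¬ (fun t : ℝ => t ^ b) =O[cobounded ℝ] (fun t => t ^ a) := fun {a b} hab hO => by
    have h1 := hO.trans_isLittleO (isLittleO_pow_pow_cobounded_of_lt (R := ℝ) hab)
    refine isLittleO_irrefl ?_ h1
    exact ((eventually_ne_cobounded (0 : ℝ)).mono fun t ht => pow_ne_zero b ht).frequently
  rcases lt_trichotomy m n with hmn | hmn | hmn
  · exact (key hmn h.2).elim
  · exact hmn
  · exact (key hmn h.1).elim

variable {f g : ℝ[X]} {c : ℝ}

theorem natDegree_pos_of_intertwine (hf : 0 < f.natDegree)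
    (hfg : ∀ t, c * g.eval (φ t) = f.eval t) : 0 < g.natDegree := by
  by_contra! h0
  rw [Polynomial.eq_C_of_natDegree_le_zero h0] at hfg
  have : f = C (c * g.coeff 0) := by
    refine Polynomial.funext fun t => ?_
    rw [← hfg t]; simp
  rw [this, natDegree_C] at hf
  exact hf.false

/-- A bi-Lipschitz φ has the exact order of t at infinity, so the two sides have the exact orders of
t^deg g and t^deg f. -/
theorem IsMonoBiLipschitz.natDegree_eq (h : IsMonoBiLipschitz φ) (hc : c ≠ 0)
    (hf : 0 < f.natDegree) (hfg : ∀ t, c * g.eval (φ t) = f.eval t) :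
    g.natDegree = f.natDegree := by
  have hg := natDegree_pos_of_intertwine hf hfg
  have h1 := h.isTheta_eval_comp (P := g) (by rintro rfl; simp at hg)
  have h2 := isTheta_eval_cobounded (P := f) (by rintro rfl; simp at hf)
  simp_rw [← hfg] at h2
  exact eq_of_pow_isTheta_pow (h1.symm.trans ((isTheta_const_mul_left hc).mp h2))

/-- The slope at infinity of an increasing bi-Lipschitz `φ` with `c * g ∘ φ = f`. -/
noncomputable def endSlope (c : ℝ) (g f : ℝ[X]) : ℝ :=
  (|f.leadingCoeff| / (|c| * |g.leadingCoeff|)) ^ ((f.natDegree : ℝ)⁻¹)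

theorem endSlope_pos (hc : c ≠ 0) (hf : f ≠ 0) (hg : g ≠ 0) : 0 < endSlope c g f := by
  have := leadingCoeff_ne_zero.mpr hf
  have := leadingCoeff_ne_zero.mpr hg
  unfold endSlope
  positivity

theorem endSlope_inv (hd : g.natDegree = f.natDegree) :
    endSlope c⁻¹ f g = (endSlope c g f)⁻¹ := by
  unfold endSlope
  rw [← Real.inv_rpow (by positivity), hd]
  congr 1
  simp only [abs_inv, div_eq_mul_inv, mul_inv, inv_inv]
  ring

theorem tendsto_eval_div_pow_cobounded (P : ℝ[X]) :
    Tendsto (fun t => P.eval t / t ^ P.natDegree) (cobounded ℝ) (𝓝 P.leadingCoeff) := by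
  have h1 := (isEquivalent_cobounded_leading_monomial (P := P)).div
    (IsEquivalent.refl (u := fun t : ℝ => t ^ P.natDegree))
  refine h1.symm.tendsto_nhds (tendsto_const_nhds.congr' ?_)
  filter_upwards [eventually_ne_cobounded (0 : ℝ)] with t ht
  simp [ht]

/-- With m the common degree, comparing leading terms gives the limit of (φ(t)/t)^m; this determines
|φ(t)/t|, and monotonicity settles the sign. -/
theorem IsMonoBiLipschitz.tendsto_slope (h : IsMonoBiLipschitz φ) (hc : c ≠ 0)
    (hf : 0 < f.natDegree) (hfg : ∀ t, c * g.eval (φ t) = f.eval t) :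
    Tendsto (fun t => φ t / t) (cobounded ℝ) (𝓝 (endSlope c g f)) := by
  have hg := natDegree_pos_of_intertwine hf hfg
  have hd := h.natDegree_eq hc hf hfg
  have hf0 : f ≠ 0 := by rintro rfl; simp at hf
  have hg0 : g ≠ 0 := by rintro rfl; simp at hg
  have hφ0 : ∀ᶠ t : ℝ in cobounded ℝ, φ t ≠ 0 :=
    h.tendsto_cobounded.eventually (eventually_ne_cobounded (0 : ℝ))
  have h1 := tendsto_eval_div_pow_cobounded f
  have h2 := (tendsto_eval_div_pow_cobounded g).comp h.tendsto_cobounded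
  have h3 : Tendsto (fun t => (φ t / t) ^ f.natDegree) (cobounded ℝ)
      (𝓝 (f.leadingCoeff / (c * g.leadingCoeff))) := by
    refine (h1.div (h2.const_mul c) (mul_ne_zero hc (leadingCoeff_ne_zero.mpr hg0))).congr' ?_
    have hgz := h.tendsto_cobounded.eventually
      ((tendsto_eval_div_pow_cobounded g).eventually_ne (leadingCoeff_ne_zero.mpr hg0))
    filter_upwards [eventually_ne_cobounded (0 : ℝ), hφ0, hgz] with t ht hφt hgt
    have : g.eval (φ t) ≠ 0 := by
      intro h0; simp [h0] at hgt
    simp only [Function.comp, Pi.div_apply]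
    rw [← hfg t, hd, div_pow]
    field_simp
  have h4 : Tendsto (fun t => |φ t / t|) (cobounded ℝ) (𝓝 (endSlope c g f)) := by
    have h5 := (h3.abs).rpow_const (p := (f.natDegree : ℝ)⁻¹) (Or.inr (by positivity))
    rw [abs_div, abs_mul] at h5
    refine h5.congr fun t => ?_
    rw [abs_pow, Real.pow_rpow_inv_natCast (abs_nonneg _) hf.ne']
  refine h4.congr' ?_
  -- Outside the interval between 0 and φ⁻¹(0), t and φ(t) have the same sign.
  have h6 : ∀ᶠ t : ℝ in cobounded ℝ, t ∉ Set.Icc (φ.symm 0 ⊓ 0) (φ.symm 0 ⊔ 0) :=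
    isBounded_def.mp (Metric.isBounded_Icc _ _)
  filter_upwards [h6] with t ht
  rw [abs_of_nonneg]
  simp only [Set.mem_Icc, not_and_or, not_le, lt_inf_iff, sup_lt_iff] at ht
  rcases ht with ht | ht
  · refine div_nonneg_of_nonpos ?_ ht.2.le
    have := (h.strictMono ht.1).le
    simpa using this
  · refine div_nonneg ?_ ht.2.le
    have := (h.strictMono ht.1).le
    simpa using this

/-- The top monomial satisfies Euler's identity, so the leading terms cancel. -/
theorem isBigO_mul_derivative_sub (P : ℝ[X]) (hP : 0 < P.natDegree) :
    (fun t => t * P.derivative.eval t - P.natDegree * P.eval t)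
      =O[cobounded ℝ] (fun t => t ^ (P.natDegree - 1)) := by
  have h1 : (X * derivative P - C (P.natDegree : ℝ) * P).degree ≤
      (X ^ (P.natDegree - 1) : ℝ[X]).degree := by
    rw [degree_X_pow, degree_le_iff_coeff_zero]
    intro n hn
    have hn' : P.natDegree ≤ n := by
      have : P.natDegree - 1 < n := by exact_mod_cast hn
      omega
    obtain ⟨k, rfl⟩ : ∃ k, n = k + 1 := ⟨n - 1, by omega⟩
    rw [coeff_sub, coeff_X_mul, coeff_derivative, coeff_C_mul]
    rcases hn'.eq_or_lt with he | hl
    · rw [he]; push_cast; ring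
    · rw [coeff_eq_zero_of_natDegree_lt hl]; simp
  simpa using isBigO_cobounded_of_degree_le h1

/-- The intercept `φ t - t φ' t` of the tangent line is bounded. -/
theorem IsMonoBiLipschitz.exists_abs_sub_mul_deriv_le (h : IsMonoBiLipschitz φ) (hc : c ≠ 0)
    (hf : 0 < f.natDegree) (hfg : ∀ t, c * g.eval (φ t) = f.eval t) :
    ∃ C, ∀ t, |φ t - t * deriv φ t| ≤ C := by
  have hg := natDegree_pos_of_intertwine hf hfg
  have hd := h.natDegree_eq hc hf hfg
  have hg' : derivative g ≠ 0 := by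
    intro h0
    have := derivative_eq_zero.mp h0
    omega
  have hderiv : ∀ t, c * (g.derivative.eval (φ t) * deriv φ t) = f.derivative.eval t := fun t => by
    have h1 : HasDerivAt φ (deriv φ t) t :=
      (h.contDiff.differentiable one_ne_zero t).hasDerivAt
    have h2 := ((g.hasDerivAt (φ t)).comp t h1).const_mul c
    have h3 : (fun t => c * (((fun x => g.eval x) ∘ φ) t)) = fun t => f.eval t := by
      funext t; exact hfg t
    rw [h3] at h2
    exact h2.unique (f.hasDerivAt t)
  -- With m the common degree, φ - tφ' = (cφ g'(φ) - t f') / (c g'(φ)). Since m c g(φ) = m f, these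
  -- terms may be inserted in the numerator, which is then O(t^(m-1)), the exact order of the
  -- denominator.
  have hnum : (fun t => c * (φ t * g.derivative.eval (φ t) - g.natDegree * g.eval (φ t)) -
      (t * f.derivative.eval t - f.natDegree * f.eval t)) =O[cobounded ℝ]
      (fun t => t ^ (f.natDegree - 1)) := by
    refine IsBigO.sub ?_ (isBigO_mul_derivative_sub f hf)
    have h1 := (isBigO_mul_derivative_sub g hg).comp_tendsto h.tendsto_cobounded
    rw [hd] at h1
    rw [hd]
    exact (h1.trans (h.isTheta_id.pow _).1).const_mul_left c
  have hden : (fun t => c * g.derivative.eval (φ t)) =Θ[cobounded ℝ]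
      (fun t => t ^ (f.natDegree - 1)) := by
    have h1 := h.isTheta_eval_comp hg'
    rw [natDegree_derivative, hd] at h1
    exact (isTheta_const_mul_left hc).mpr h1
  have hquot := hnum.mul hden.inv.1
  have hO : (fun t => φ t - t * deriv φ t) =O[cobounded ℝ] (fun _ => (1 : ℝ)) := by
    refine hquot.congr' ?_ ?_
    · have hz : ∀ᶠ t : ℝ in cobounded ℝ, c * g.derivative.eval (φ t) ≠ 0 := by
        filter_upwards [hden.eq_zero_iff, eventually_ne_cobounded (0 : ℝ)] with t ht ht' h0
        exact pow_ne_zero _ ht' (ht.mp h0)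
      filter_upwards [hz] with t ht
      rw [← hderiv t, ← hfg t, hd, ← div_eq_mul_inv, div_eq_iff ht]
      ring
    · filter_upwards [eventually_ne_cobounded (0 : ℝ)] with t ht
      exact mul_inv_cancel₀ (pow_ne_zero _ ht)
  obtain ⟨C₁, hC₁⟩ := hO.bound
  have hK : IsCompact (closure {t | ¬ ‖φ t - t * deriv φ t‖ ≤ C₁ * ‖(1 : ℝ)‖}) :=
    (isBounded_compl_iff.mpr hC₁).isCompact_closure
  have hcont : Continuous fun t => φ t - t * deriv φ t :=
    h.contDiff.continuous.sub (continuous_id.mul (h.contDiff.continuous_deriv le_rfl))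
  obtain ⟨C₂, hC₂⟩ := hK.exists_bound_of_continuousOn hcont.continuousOn
  refine ⟨max C₁ C₂, fun t => ?_⟩
  by_cases ht : ‖φ t - t * deriv φ t‖ ≤ C₁ * ‖(1 : ℝ)‖
  · exact le_max_of_le_left (by simpa using ht)
  · exact le_max_of_le_right (hC₂ t (subset_closure ht))

end EndBehaviour

/-! ### The half-plane maps, their Lipschitz bounds and their gluing. -/

section HalfPlane

open Filter Bornology

/-- `φ` is asymptotic to the line of slope `L` at both ends, with tangents of bounded intercept,
and so is its inverse (with slope `L⁻¹`). -/
structure HasLinearEnds (φ : ℝ ≃ ℝ) (L : ℝ) : Prop where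
  mono : IsMonoBiLipschitz φ
  slope_pos : 0 < L
  slope : Tendsto (fun t => φ t / t) (cobounded ℝ) (𝓝 L)
  slope_symm : Tendsto (fun t => φ.symm t / t) (cobounded ℝ) (𝓝 L⁻¹)
  intercept : ∃ C, ∀ t, |φ t - t * deriv φ t| ≤ C
  intercept_symm : ∃ C, ∀ t, |φ.symm t - t * deriv φ.symm t| ≤ C

theorem HasLinearEnds.symm {φ : ℝ ≃ ℝ} {L : ℝ} (h : HasLinearEnds φ L) :
    HasLinearEnds φ.symm L⁻¹ where
  mono := h.mono.symm
  slope_pos := inv_pos.mpr h.slope_pos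
  slope := h.slope_symm
  slope_symm := by simpa using h.slope
  intercept := h.intercept_symm
  intercept_symm := h.intercept

theorem IsMonoBiLipschitz.hasLinearEnds {φ : ℝ ≃ ℝ} (h : IsMonoBiLipschitz φ)
    {f g : Polynomial ℝ} {c : ℝ} (hc : c ≠ 0) (hf : 0 < f.natDegree)
    (hfg : ∀ t, c * g.eval (φ t) = f.eval t) : HasLinearEnds φ (endSlope c g f) := by
  have hg := natDegree_pos_of_intertwine hf hfg
  have hgf : ∀ t, c⁻¹ * f.eval (φ.symm t) = g.eval t := fun t => by
    rw [← hfg, φ.apply_symm_apply, inv_mul_cancel_left₀ hc]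
  refine ⟨h, endSlope_pos hc ?_ ?_, h.tendsto_slope hc hf hfg, ?_,
    h.exists_abs_sub_mul_deriv_le hc hf hfg,
    h.symm.exists_abs_sub_mul_deriv_le (inv_ne_zero hc) hg hgf⟩
  · rintro rfl; simp at hf
  · rintro rfl; simp at hg
  · rw [← endSlope_inv (h.natDegree_eq hc hf hfg)]
    exact h.symm.tendsto_slope (inv_ne_zero hc) hg hgf

variable {φ : ℝ ≃ ℝ} {L a β : ℝ}

/-- The perspective `u * φ (y / u)` of `φ`, extended to `u = 0` by its limit. -/
noncomputable def perspective (φ : ℝ → ℝ) (L u y : ℝ) : ℝ :=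
  if u = 0 then L * y else u * φ (y / u)

theorem HasLinearEnds.tendsto_perspective (h : HasLinearEnds φ L) (y : ℝ) :
    Tendsto (fun u => perspective φ L u y) (𝓝[>] 0) (𝓝 (perspective φ L 0 y)) := by
  have h0 : perspective φ L 0 y = L * y := by simp [perspective]
  rw [h0]
  rcases eq_or_ne y 0 with rfl | hy
  · have h1 : Tendsto (fun u : ℝ => u * φ 0) (𝓝[>] 0) (𝓝 (0 * φ 0)) :=
      (tendsto_id.mono_left nhdsWithin_le_nhds).mul_const _
    rw [zero_mul] at h1
    rw [mul_zero]
    refine h1.congr' ?_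
    filter_upwards [self_mem_nhdsWithin] with u hu
    simp [perspective, (Set.mem_Ioi.mp hu).ne']
  · have h1 : Tendsto (fun u : ℝ => y / u) (𝓝[>] 0) (cobounded ℝ) := by
      have h2 : Tendsto (fun u : ℝ => u / y) (𝓝[>] 0) (𝓝[≠] 0) := by
        refine tendsto_nhdsWithin_iff.mpr ⟨?_, ?_⟩
        · have : Tendsto (fun u : ℝ => u / y) (𝓝[>] 0) (𝓝 (0 / y)) :=
            (tendsto_id.mono_left nhdsWithin_le_nhds).div_const _
          simpa using this
        · filter_upwards [self_mem_nhdsWithin] with u hu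
          exact div_ne_zero (Set.mem_Ioi.mp hu).ne' hy
      have h3 := (tendsto_inv₀_nhdsNE_zero (α := ℝ)).comp h2
      simpa [Function.comp_def] using h3
    refine ((h.slope.comp h1).mul_const y).congr' ?_
    filter_upwards [self_mem_nhdsWithin] with u hu
    have hu' := (Set.mem_Ioi.mp hu).ne'
    simp only [Function.comp, perspective, hu', if_false]
    field_simp

/-- In u, the derivative of uφ(y/u) is the tangent intercept at y/u, bounded uniformly in y, and the
bound passes to u = 0 in the limit. In y, the factors u and 1/u cancel, leaving the Lipschitz
constant of φ, or L at u = 0. -/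
theorem HasLinearEnds.exists_perspective_sub_le (h : HasLinearEnds φ L) :
    ∃ K, 0 ≤ K ∧ ∀ u u' y y' : ℝ, 0 ≤ u → 0 ≤ u' →
      |perspective φ L u y - perspective φ L u' y'| ≤ K * |u - u'| + K * |y - y'| := by
  obtain ⟨C, hC⟩ := h.intercept
  obtain ⟨K, hK⟩ := h.mono.lipschitz
  have hC0 : 0 ≤ C := (abs_nonneg _).trans (hC 0)
  have hpos : ∀ y u u' : ℝ, 0 < u → 0 < u' →
      |perspective φ L u y - perspective φ L u' y| ≤ C * |u - u'| := fun y u u' hu hu' => by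
    have hd : ∀ x ∈ Set.Ioi (0 : ℝ), HasDerivWithinAt (fun x => x * φ (y / x))
        (φ (y / x) - y / x * deriv φ (y / x)) (Set.Ioi 0) x := fun x hx => by
      have hx0 : x ≠ 0 := (Set.mem_Ioi.mp hx).ne'
      have h1 : HasDerivAt φ (deriv φ (y / x)) (y / x) :=
        (h.mono.contDiff.differentiable one_ne_zero _).hasDerivAt
      have h2 : HasDerivAt (fun x => y / x) (-y / x ^ 2) x :=
        ((hasDerivAt_const x y).div (hasDerivAt_id x) hx0).congr_deriv (by simp)
      have h3 := (hasDerivAt_id x).mul (h1.comp x h2)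
      refine (h3.congr_deriv ?_).hasDerivWithinAt
      simp only [id, Function.comp]
      field_simp
      ring
    have := (convex_Ioi (0 : ℝ)).norm_image_sub_le_of_norm_hasDerivWithin_le hd
      (fun x _ => hC (y / x)) (Set.mem_Ioi.mpr hu') (Set.mem_Ioi.mpr hu)
    simpa [perspective, hu.ne', hu'.ne'] using this
  have hzero : ∀ y u : ℝ, 0 < u →
      |perspective φ L u y - perspective φ L 0 y| ≤ C * |u - 0| := fun y u hu => by
    refine le_of_tendsto_of_tendsto ((tendsto_const_nhds.sub (h.tendsto_perspective y)).abs)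
      (((tendsto_const_nhds.sub tendsto_id).abs.const_mul C).mono_left nhdsWithin_le_nhds) ?_
    filter_upwards [self_mem_nhdsWithin] with u' hu'
    exact hpos y u u' hu hu'
  have hfst : ∀ y u u' : ℝ, 0 ≤ u → 0 ≤ u' →
      |perspective φ L u y - perspective φ L u' y| ≤ C * |u - u'| := fun y u u' hu hu' => by
    rcases hu.eq_or_lt with rfl | hu <;> rcases hu'.eq_or_lt with rfl | hu'
    · simp
    · rw [abs_sub_comm, abs_sub_comm 0]; exact hzero y u' hu'
    · exact hzero y u hu
    · exact hpos y u u' hu hu'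
  have hsnd : ∀ u y y' : ℝ, 0 ≤ u →
      |perspective φ L u y - perspective φ L u y'| ≤ max L K * |y - y'| := fun u y y' hu => by
    rcases hu.eq_or_lt with rfl | hu
    · simp only [perspective, if_true, ← mul_sub, abs_mul, abs_of_pos h.slope_pos]
      exact mul_le_mul_of_nonneg_right (le_max_left _ _) (abs_nonneg _)
    · simp only [perspective, hu.ne', if_false, ← mul_sub, abs_mul, abs_of_pos hu]
      have h1 := hK.dist_le_mul (y / u) (y' / u)
      rw [Real.dist_eq, Real.dist_eq, ← sub_div, abs_div, abs_of_pos hu] at h1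
      calc u * |φ (y / u) - φ (y' / u)| ≤ u * (K * (|y - y'| / u)) := by gcongr
        _ = K * |y - y'| := by field_simp
        _ ≤ _ := mul_le_mul_of_nonneg_right (le_max_right _ _) (abs_nonneg _)
  refine ⟨max C (max L K), le_max_of_le_left hC0, fun u u' y y' hu hu' => ?_⟩
  calc _ ≤ |perspective φ L u y - perspective φ L u' y| +
        |perspective φ L u' y - perspective φ L u' y'| := abs_sub_le _ _ _
    _ ≤ C * |u - u'| + max L K * |y - y'| := add_le_add (hfst _ _ _ hu hu') (hsnd _ _ _ hu')
    _ ≤ _ := by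
      exact add_le_add (mul_le_mul_of_nonneg_right (le_max_left _ _) (abs_nonneg _))
        (mul_le_mul_of_nonneg_right (le_max_right _ _) (abs_nonneg _))

/-- The map `(x, y) ↦ (a x, |a x| ^ β φ (y / |x| ^ β))`, extended to the axis `x = 0`. -/
noncomputable def halfMap (β a : ℝ) (φ : ℝ → ℝ) (L : ℝ) (p : ℝ × ℝ) : ℝ × ℝ :=
  (a * p.1, a ^ β * perspective φ L (|p.1| ^ β) p.2)

theorem abs_rpow_sub_le (hβ : 1 ≤ β) {R x x' : ℝ} (hx : |x| ≤ R) (hx' : |x'| ≤ R) :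
    |(|x| ^ β - |x'| ^ β)| ≤ β * R ^ (β - 1) * |x - x'| := by
  have hd : ∀ t ∈ Set.Icc (0 : ℝ) R,
      HasDerivWithinAt (fun t : ℝ => t ^ β) (β * t ^ (β - 1)) (Set.Icc 0 R) t :=
    fun t _ => (Real.hasDerivAt_rpow_const (Or.inr hβ)).hasDerivWithinAt
  have h1 := (convex_Icc (0 : ℝ) R).norm_image_sub_le_of_norm_hasDerivWithin_le hd
    (C := β * R ^ (β - 1)) (fun t ht => ?_) ⟨abs_nonneg x', hx'⟩ ⟨abs_nonneg x, hx⟩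
  · refine h1.trans (mul_le_mul_of_nonneg_left (abs_abs_sub_abs_le_abs_sub x x') ?_)
    have := (abs_nonneg x).trans hx
    positivity
  · rw [Real.norm_eq_abs, abs_mul, abs_of_nonneg (zero_le_one.trans hβ),
      abs_of_nonneg (Real.rpow_nonneg ht.1 _)]
    have := ht.1
    exact mul_le_mul_of_nonneg_left (Real.rpow_le_rpow ht.1 ht.2 (by linarith)) (by linarith)

theorem HasLinearEnds.exists_lipschitzOnWith_halfMap (h : HasLinearEnds φ L) (hβ : 1 ≤ β)
    (ha : 0 < a) (R : ℝ) :
    ∃ K, LipschitzOnWith K (halfMap β a φ L) {p | |p.1| ≤ R} := by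
  rcases lt_or_ge R 0 with hR | hR
  · refine ⟨0, fun p hp => ?_⟩
    exact absurd ((abs_nonneg _).trans hp) (not_le.mpr hR)
  obtain ⟨K, hK0, hK⟩ := h.exists_perspective_sub_le
  have hB : 0 ≤ β * R ^ (β - 1) := by positivity
  have hA : 0 < a ^ β := Real.rpow_pos_of_pos ha β
  have hD : 0 ≤ a + a ^ β * (K * (β * R ^ (β - 1)) + K) := by positivity
  refine ⟨NNReal.mk _ hD, LipschitzOnWith.of_dist_le_mul fun p hp q hq => ?_⟩
  have h1 : |p.1 - q.1| ≤ dist p q := by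
    rw [← Real.dist_eq]; exact le_max_left _ _
  have h2 : |p.2 - q.2| ≤ dist p q := by
    rw [← Real.dist_eq]; exact le_max_right _ _
  have hd : 0 ≤ dist p q := dist_nonneg
  rw [NNReal.coe_mk, Prod.dist_eq (x := halfMap β a φ L p)]
  refine max_le ?_ ?_
  · simp only [halfMap, Real.dist_eq, ← mul_sub, abs_mul, abs_of_pos ha]
    rw [add_mul]
    exact le_add_of_le_of_nonneg (by gcongr) (by positivity)
  · simp only [halfMap, Real.dist_eq, ← mul_sub, abs_mul, abs_of_pos hA]
    calc _ ≤ a ^ β * (K * |(|p.1| ^ β - |q.1| ^ β)| + K * |p.2 - q.2|) := by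
          gcongr
          exact hK _ _ _ _ (by positivity) (by positivity)
      _ ≤ a ^ β * (K * (β * R ^ (β - 1) * dist p q) + K * dist p q) := by
          gcongr
          exact (abs_rpow_sub_le hβ hp hq).trans (by gcongr)
      _ = a ^ β * (K * (β * R ^ (β - 1)) + K) * dist p q := by ring
      _ ≤ _ := by
          rw [add_mul]
          exact le_add_of_nonneg_left (by positivity)

theorem halfMap_symm_halfMap (hL : L ≠ 0) (hβ : β ≠ 0) (ha : 0 < a) (p : ℝ × ℝ) :
    halfMap β a⁻¹ φ.symm L⁻¹ (halfMap β a φ L p) = p := by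
  have hA : 0 < a ^ β := Real.rpow_pos_of_pos ha β
  obtain ⟨x, y⟩ := p
  have hx1 : a⁻¹ * (a * x) = x := by field_simp
  simp only [halfMap, hx1, Prod.mk.injEq, true_and, abs_mul, abs_of_pos ha,
    Real.mul_rpow ha.le (abs_nonneg x), Real.inv_rpow ha.le]
  rcases eq_or_ne x 0 with rfl | hx
  · simp only [abs_zero, Real.zero_rpow hβ, mul_zero, perspective, if_true]
    field_simp
  · have hX : 0 < |x| ^ β := Real.rpow_pos_of_pos (abs_pos.mpr hx) β
    simp only [perspective, hX.ne', (mul_pos hA hX).ne', if_false]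
    rw [show a ^ β * (|x| ^ β * φ (y / |x| ^ β)) / (a ^ β * |x| ^ β) = φ (y / |x| ^ β) by
      field_simp, φ.symm_apply_apply]
    field_simp

/-- Two half maps glued along the axis `x = 0`. -/
noncomputable def glueMap (β a₁ : ℝ) (φ₁ : ℝ → ℝ) (L₁ a₂ : ℝ) (φ₂ : ℝ → ℝ) (L₂ : ℝ)
    (p : ℝ × ℝ) : ℝ × ℝ :=
  if 0 ≤ p.1 then halfMap β a₁ φ₁ L₁ p else halfMap β a₂ φ₂ L₂ p

variable {φ₁ φ₂ : ℝ ≃ ℝ} {a₁ a₂ L₁ L₂ : ℝ}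

/-- On the axis the two halves are y ↦ aᵢ^β Lᵢ y; `hL` is exactly their agreement there. -/
theorem glueMap_of_nonpos {φ₁ φ₂ : ℝ → ℝ} (hβ : β ≠ 0) (hL : a₁ ^ β * L₁ = a₂ ^ β * L₂)
    {p : ℝ × ℝ} (hp : p.1 ≤ 0) :
    glueMap β a₁ φ₁ L₁ a₂ φ₂ L₂ p = halfMap β a₂ φ₂ L₂ p := by
  unfold glueMap
  split_ifs with h
  · have h0 : p.1 = 0 := le_antisymm hp h
    simp only [halfMap, h0, abs_zero, Real.zero_rpow hβ, perspective, if_true, mul_zero,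
      ← mul_assoc, hL]
  · rfl

theorem exists_lipschitzOnWith_glueMap (h₁ : HasLinearEnds φ₁ L₁) (h₂ : HasLinearEnds φ₂ L₂)
    (hβ : 1 ≤ β) (ha₁ : 0 < a₁) (ha₂ : 0 < a₂) (hL : a₁ ^ β * L₁ = a₂ ^ β * L₂) (R : ℝ) :
    ∃ K, LipschitzOnWith K (glueMap β a₁ φ₁ L₁ a₂ φ₂ L₂) {p | |p.1| ≤ R} := by
  obtain ⟨K₁, hK₁⟩ := h₁.exists_lipschitzOnWith_halfMap hβ ha₁ R
  obtain ⟨K₂, hK₂⟩ := h₂.exists_lipschitzOnWith_halfMap hβ ha₂ R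
  have hβ0 : β ≠ 0 := by linarith
  set Φ := glueMap β a₁ φ₁ L₁ a₂ φ₂ L₂ with hΦ
  have e₁ : ∀ p : ℝ × ℝ, 0 ≤ p.1 → Φ p = halfMap β a₁ φ₁ L₁ p := fun p hp => if_pos hp
  have e₂ : ∀ p : ℝ × ℝ, p.1 ≤ 0 → Φ p = halfMap β a₂ φ₂ L₂ p :=
    fun p hp => glueMap_of_nonpos hβ0 hL hp
  -- Points on opposite sides are compared through the axis point (0, q.2), which in the sup metric
  -- is no farther from either than they are from each other.
  have hcross : ∀ p q : ℝ × ℝ, |p.1| ≤ R → |q.1| ≤ R → 0 ≤ p.1 → q.1 ≤ 0 →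
      dist (Φ p) (Φ q) ≤ (K₁ + K₂) * dist p q := fun p q hp hq hp0 hq0 => by
    have hz : ((0 : ℝ), q.2) ∈ {p : ℝ × ℝ | |p.1| ≤ R} := by
      simpa using (abs_nonneg _).trans hp
    have h3 := hK₁.dist_le_mul p hp _ hz
    have h4 := hK₂.dist_le_mul _ hz q hq
    rw [← e₁ p hp0, ← e₁ _ le_rfl] at h3
    rw [← e₂ q hq0, ← e₂ _ le_rfl] at h4
    have hd1 : |p.1 - q.1| ≤ dist p q := by
      rw [← Real.dist_eq]; exact le_max_left _ _
    have hd2 : dist p.2 q.2 ≤ dist p q := le_max_right _ _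
    have hd := le_abs_self (p.1 - q.1)
    have h5 : dist p (0, q.2) ≤ dist p q := by
      refine max_le ?_ hd2
      rw [Real.dist_eq, sub_zero, abs_of_nonneg hp0]; linarith
    have h6 : dist ((0 : ℝ), q.2) q ≤ dist p q := by
      refine max_le ?_ (by simp [dist_nonneg])
      rw [Real.dist_eq, zero_sub, abs_neg, abs_of_nonpos hq0]; linarith
    calc dist (Φ p) (Φ q) ≤ dist (Φ p) (Φ (0, q.2)) + dist (Φ (0, q.2)) (Φ q) :=
          dist_triangle _ _ _
      _ ≤ K₁ * dist p q + K₂ * dist p q :=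
          add_le_add (h3.trans (by gcongr)) (h4.trans (by gcongr))
      _ = _ := by ring
  refine ⟨K₁ + K₂, LipschitzOnWith.of_dist_le_mul fun p hp q hq => ?_⟩
  rw [NNReal.coe_add]
  have hd : 0 ≤ dist p q := dist_nonneg
  rcases le_total 0 p.1 with hp0 | hp0 <;> rcases le_total 0 q.1 with hq0 | hq0
  · rw [e₁ p hp0, e₁ q hq0]
    exact (hK₁.dist_le_mul p hp q hq).trans (by gcongr; simp)
  · exact hcross p q hp hq hp0 hq0
  · rw [dist_comm, dist_comm p q]; exact hcross q p hq hp hq0 hp0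
  · rw [e₂ p hp0, e₂ q hq0]
    exact (hK₂.dist_le_mul p hp q hq).trans (by gcongr; simp)

theorem glueMap_symm_glueMap (hL₁ : L₁ ≠ 0) (hL₂ : L₂ ≠ 0) (hβ : β ≠ 0) (ha₁ : 0 < a₁)
    (ha₂ : 0 < a₂) (p : ℝ × ℝ) :
    glueMap β a₁⁻¹ φ₁.symm L₁⁻¹ a₂⁻¹ φ₂.symm L₂⁻¹ (glueMap β a₁ φ₁ L₁ a₂ φ₂ L₂ p) = p := by
  rcases le_or_gt 0 p.1 with hp | hp
  · have h1 : glueMap β a₁ φ₁ L₁ a₂ φ₂ L₂ p = halfMap β a₁ φ₁ L₁ p := if_pos hp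
    have h2 : 0 ≤ (halfMap β a₁ φ₁ L₁ p).1 := mul_nonneg ha₁.le hp
    rw [h1, glueMap, if_pos h2, halfMap_symm_halfMap hL₁ hβ ha₁]
  · have h1 : glueMap β a₁ φ₁ L₁ a₂ φ₂ L₂ p = halfMap β a₂ φ₂ L₂ p := if_neg (not_le.mpr hp)
    have h2 : ¬ 0 ≤ (halfMap β a₂ φ₂ L₂ p).1 := not_le.mpr (mul_neg_of_pos_of_neg ha₂ hp)
    rw [h1, glueMap, if_neg h2, halfMap_symm_halfMap hL₂ hβ ha₂]

/-- The glued map as a homeomorphism from the strip `|x| < 1` onto its image. -/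
noncomputable def glueHomeo (h₁ : HasLinearEnds φ₁ L₁) (h₂ : HasLinearEnds φ₂ L₂)
    (hβ : 1 ≤ β) (ha₁ : 0 < a₁) (ha₂ : 0 < a₂) (hL : a₁ ^ β * L₁ = a₂ ^ β * L₂) :
    OpenPartialHomeomorph (ℝ × ℝ) (ℝ × ℝ) where
  toFun := glueMap β a₁ φ₁ L₁ a₂ φ₂ L₂
  invFun := glueMap β a₁⁻¹ φ₁.symm L₁⁻¹ a₂⁻¹ φ₂.symm L₂⁻¹
  source := {p | -1 < p.1 ∧ p.1 < 1}
  target := {p | -a₂ < p.1 ∧ p.1 < a₁}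
  map_source' := by
    rintro ⟨x, y⟩ ⟨hx, hx'⟩
    simp only [glueMap, halfMap, Set.mem_ofPred_eq] at *
    split_ifs with h <;> simp only <;> constructor <;> nlinarith
  map_target' := by
    rintro ⟨x, y⟩ ⟨hx, hx'⟩
    simp only [glueMap, halfMap, Set.mem_ofPred_eq] at *
    split_ifs with h <;> simp only [inv_mul_eq_div]
    · rw [lt_div_iff₀ ha₁, div_lt_iff₀ ha₁]; constructor <;> linarith
    · rw [lt_div_iff₀ ha₂, div_lt_iff₀ ha₂]; constructor <;> linarith
  left_inv' := fun p _ => glueMap_symm_glueMap h₁.slope_pos.ne' h₂.slope_pos.ne' (by linarith)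
    ha₁ ha₂ p
  right_inv' := fun p _ => by
    have := glueMap_symm_glueMap (φ₁ := φ₁.symm) (φ₂ := φ₂.symm) (β := β)
      h₁.symm.slope_pos.ne' h₂.symm.slope_pos.ne' (by linarith) (inv_pos.mpr ha₁)
      (inv_pos.mpr ha₂) p
    simpa using this
  open_source := (isOpen_lt continuous_const continuous_fst).inter
    (isOpen_lt continuous_fst continuous_const)
  open_target := (isOpen_lt continuous_const continuous_fst).inter
    (isOpen_lt continuous_fst continuous_const)
  continuousOn_toFun := by
    obtain ⟨K, hK⟩ := exists_lipschitzOnWith_glueMap h₁ h₂ hβ ha₁ ha₂ hL 1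
    exact hK.continuousOn.mono fun p hp => abs_le.mpr ⟨hp.1.le, hp.2.le⟩
  continuousOn_invFun := by
    obtain ⟨K, hK⟩ := exists_lipschitzOnWith_glueMap h₁.symm h₂.symm hβ (inv_pos.mpr ha₁)
      (inv_pos.mpr ha₂) (by simp only [Real.inv_rpow ha₁.le, Real.inv_rpow ha₂.le, ← mul_inv, hL])
      (max a₁ a₂)
    refine hK.continuousOn.mono fun p hp => abs_le.mpr ⟨?_, hp.2.le.trans (le_max_left _ _)⟩
    have := le_max_right a₁ a₂
    linarith [hp.1]

end HalfPlane

/-! ### Semialgebraicity of the glued map, and the equivalence it realises. -/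

section Germ

open Filter

theorem eval_bind₁_pair {κ : Type} (F : MvPolynomial (Fin 2) ℝ) (p q : MvPolynomial κ ℝ)
    (v : κ → ℝ) : MvPolynomial.eval v (MvPolynomial.bind₁ ![p, q] F) =
      evalAt F (MvPolynomial.eval v p) (MvPolynomial.eval v q) := by
  simp only [← MvPolynomial.aeval_eq_eval, MvPolynomial.aeval_bind₁, evalAt]
  congr 2
  funext i
  fin_cases i <;> rfl

theorem continuous_evalAt (F : MvPolynomial (Fin 2) ℝ) :
    Continuous fun p : ℝ × ℝ => evalAt F p.1 p.2 := by
  refine (MvPolynomial.continuous_eval F).comp (continuous_pi fun i => ?_)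
  fin_cases i
  · exact continuous_fst
  · exact continuous_snd

/-- The one-variable polynomial `F(ε, t)`. -/
noncomputable def heightPoly (ε : ℝ) (F : MvPolynomial (Fin 2) ℝ) : Polynomial ℝ :=
  MvPolynomial.aeval ![Polynomial.C ε, Polynomial.X] F

theorem eval_heightPoly (ε : ℝ) (F : MvPolynomial (Fin 2) ℝ) (t : ℝ) :
    (heightPoly ε F).eval t = evalAt F ε t := by
  have h : (Polynomial.aeval t).comp (MvPolynomial.aeval ![Polynomial.C ε, Polynomial.X]) =
      (MvPolynomial.aeval ![ε, t] : MvPolynomial (Fin 2) ℝ →ₐ[ℝ] ℝ) := by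
    refine MvPolynomial.algHom_ext fun i => ?_
    fin_cases i <;> simp
  simpa [evalAt, heightPoly, MvPolynomial.aeval_eq_eval, Polynomial.coe_aeval_eq_eval] using
    DFunLike.congr_fun h F

variable {β : ℚ} {d : ℕ} {F G : MvPolynomial (Fin 2) ℝ}

theorem IsQuasihomogeneous.evalAt_eq (hF : IsQuasihomogeneous β d F) {ε x : ℝ} (hε : ε * ε = 1)
    (hx : 0 < ε * x) (y : ℝ) :
    evalAt F x y = (ε * x) ^ d * evalAt F ε (y / (ε * x) ^ (β : ℝ)) := by
  have h := hF (ε * x) hx ε (y / (ε * x) ^ (β : ℝ))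
  have hX : 0 < (ε * x) ^ (β : ℝ) := Real.rpow_pos_of_pos hx _
  rwa [mul_div_cancel₀ _ hX.ne', show ε * x * ε = x by linear_combination x * hε] at h

/-- By Rolle, two distinct points with the same g-value have a critical point of g strictly between
them. Hence a solution of c g(h) = f(t) on the same side as φ(t) of every critical point is φ(t),
and finitely many sign conditions cut out the graph. -/
theorem IsMonoBiLipschitz.eq_iff {φ : ℝ ≃ ℝ} (hφ : IsMonoBiLipschitz φ) {f g : Polynomial ℝ}
    {c : ℝ} (hc : c ≠ 0) (hg : 0 < g.natDegree) (hfg : ∀ t, c * g.eval (φ t) = f.eval t)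
    (h t : ℝ) : h = φ t ↔ c * g.eval h = f.eval t ∧
      ∀ e ∈ g.derivative.roots.toFinset,
        (e < h ↔ φ.symm e < t) ∧ (h < e ↔ t < φ.symm e) := by
  have hg' : g.derivative ≠ 0 := fun h0 => by
    have := Polynomial.derivative_eq_zero.mp h0
    omega
  have hlt : ∀ e, (φ.symm e < t ↔ e < φ t) := fun e => by
    rw [← hφ.strictMono.lt_iff_lt, φ.apply_symm_apply]
  have hgt : ∀ e, (t < φ.symm e ↔ φ t < e) := fun e => by
    rw [← hφ.strictMono.lt_iff_lt, φ.apply_symm_apply]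
  simp only [hlt, hgt]
  constructor
  · rintro rfl
    exact ⟨hfg t, fun e _ => ⟨Iff.rfl, Iff.rfl⟩⟩
  · rintro ⟨h1, h2⟩
    have h3 : g.eval h = g.eval (φ t) := mul_left_cancel₀ hc (h1.trans (hfg t).symm)
    have rolle : ∀ a b, a < b → g.eval a = g.eval b →
        ∃ e ∈ g.derivative.roots.toFinset, a < e ∧ e < b := fun a b hab heq => by
      obtain ⟨e, he, he'⟩ := exists_deriv_eq_zero hab g.continuous.continuousOn heq
      refine ⟨e, ?_, he⟩
      rw [Polynomial.deriv] at he'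
      simpa [hg'] using he'
    rcases lt_trichotomy h (φ t) with hlt | heq | hgt
    · obtain ⟨e, he, ha, hb⟩ := rolle _ _ hlt h3
      exact absurd ((h2 e he).1.mpr hb) ha.not_gt
    · exact heq
    · obtain ⟨e, he, ha, hb⟩ := rolle _ _ hgt h3.symm
      exact absurd ((h2 e he).2.mpr ha) hb.not_gt

theorem halfMap_of_pos {β a L ε : ℝ} {φ : ℝ → ℝ} (hε : ε = 1 ∨ ε = -1) {x : ℝ}
    (hx : 0 < ε * x) (y : ℝ) : halfMap β a φ L (x, y) =
      (a * x, a ^ β * ((ε * x) ^ β * φ (y / (ε * x) ^ β))) := by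
  have habs : |x| = ε * x := by
    rcases hε with rfl | rfl
    · rw [abs_of_pos (by linarith), one_mul]
    · rw [abs_of_neg (by linarith), neg_one_mul]
  simp only [halfMap, habs, perspective, (Real.rpow_pos_of_pos hx β).ne', if_false]

/-- Clearing the weights |x|^β turns the equation of `IsMonoBiLipschitz.eq_iff` into G(v₂,v₃) =
F(v₀,v₁), and each comparison with a critical point into a position relative to a branch y = e
x^(r/s). -/
theorem IsSemialgebraic.setOf_halfMap_graph {r s : ℕ} (hs : 0 < s) (hβ : (β : ℝ) = (r : ℝ) / s)
    (hF : IsQuasihomogeneous β d F) (hG : IsQuasihomogeneous β d G) {ε a L : ℝ}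
    (hε : ε = 1 ∨ ε = -1) (ha : 0 < a) {φ : ℝ ≃ ℝ} (hφ : IsMonoBiLipschitz φ)
    (hg : 0 < (heightPoly ε G).natDegree)
    (hfg : ∀ t, a ^ d * (heightPoly ε G).eval (φ t) = (heightPoly ε F).eval t) :
    IsSemialgebraic {v : Fin 4 → ℝ |
      0 < ε * v 0 ∧ (v 2, v 3) = halfMap (β : ℝ) a φ L (v 0, v 1)} := by
  have hεε : ε * ε = 1 := by rcases hε with rfl | rfl <;> norm_num
  have key : ∀ v : Fin 4 → ℝ,
      (0 < ε * v 0 ∧ (v 2, v 3) = halfMap (β : ℝ) a φ L (v 0, v 1)) ↔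
      (0 < ε * v 0 ∧ v 2 = a * v 0 ∧ evalAt G (v 2) (v 3) = evalAt F (v 0) (v 1) ∧
        ∀ e ∈ (heightPoly ε G).derivative.roots.toFinset,
        (((0 < a * ε * v 0 ∧ e * (a * ε * v 0) ^ ((r : ℝ) / s) < v 3) ↔
          (0 < ε * v 0 ∧ φ.symm e * (ε * v 0) ^ ((r : ℝ) / s) < v 1)) ∧
         ((0 < a * ε * v 0 ∧ -e * (a * ε * v 0) ^ ((r : ℝ) / s) < -v 3) ↔
          (0 < ε * v 0 ∧ -φ.symm e * (ε * v 0) ^ ((r : ℝ) / s) < -v 1)))) := by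
    intro v
    refine and_congr_right fun hx => ?_
    have hax : 0 < ε * (a * v 0) := by
      have := mul_pos ha hx
      linarith
    have hax' : a * ε * v 0 = ε * (a * v 0) := by ring
    have hX : 0 < (ε * v 0) ^ (β : ℝ) := Real.rpow_pos_of_pos hx _
    have hA : 0 < (ε * (a * v 0)) ^ (β : ℝ) := Real.rpow_pos_of_pos hax _
    have hAX : (ε * (a * v 0)) ^ (β : ℝ) = a ^ (β : ℝ) * (ε * v 0) ^ (β : ℝ) := by
      rw [← Real.mul_rpow ha.le hx.le]; congr 1; ring
    rw [halfMap_of_pos hε hx, Prod.mk.injEq]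
    refine and_congr_right fun h2 => ?_
    have h3 : v 3 = a ^ (β : ℝ) * ((ε * v 0) ^ (β : ℝ) * φ (v 1 / (ε * v 0) ^ (β : ℝ))) ↔
        v 3 / (ε * (a * v 0)) ^ (β : ℝ) = φ (v 1 / (ε * v 0) ^ (β : ℝ)) := by
      rw [div_eq_iff hA.ne', hAX]
      constructor <;> intro h <;> rw [h] <;> ring
    rw [h3, hφ.eq_iff (pow_pos ha d).ne' hg hfg, eval_heightPoly, eval_heightPoly]
    refine and_congr ?_ (forall₂_congr fun e _ => and_congr (iff_congr ?_ ?_) (iff_congr ?_ ?_))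
    · rw [h2, hG.evalAt_eq hεε hax, hF.evalAt_eq hεε hx,
        show (ε * (a * v 0)) ^ d = (ε * v 0) ^ d * a ^ d by rw [← mul_pow]; congr 1; ring,
        mul_assoc, mul_right_inj' (pow_pos hx d).ne']
    · rw [hax', ← hβ, lt_div_iff₀ hA, and_iff_right hax]
    · rw [← hβ, lt_div_iff₀ hX, and_iff_right hx]
    · rw [hax', ← hβ, div_lt_iff₀ hA, and_iff_right hax, neg_mul, neg_lt_neg_iff]
    · rw [← hβ, div_lt_iff₀ hX, and_iff_right hx, neg_mul, neg_lt_neg_iff]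
  simp only [key]
  refine IsSemialgebraic.setOf_and ?_ (IsSemialgebraic.setOf_and ?_
    (IsSemialgebraic.setOf_and ?_ (IsSemialgebraic.setOf_forall_mem _ fun e _ =>
      IsSemialgebraic.setOf_and (IsSemialgebraic.setOf_iff ?_ ?_)
        (IsSemialgebraic.setOf_iff ?_ ?_))))
  · have := IsSemialgebraic.pos (MvPolynomial.C ε * MvPolynomial.X 0 : MvPolynomial (Fin 4) ℝ)
    simpa only [map_mul, map_neg, MvPolynomial.eval_C, MvPolynomial.eval_X] using this
  · have := IsSemialgebraic.setOf_eq (MvPolynomial.X 2 : MvPolynomial (Fin 4) ℝ)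
      (MvPolynomial.C a * MvPolynomial.X 0)
    simpa only [map_mul, map_neg, MvPolynomial.eval_C, MvPolynomial.eval_X] using this
  · have := IsSemialgebraic.setOf_eq
      (MvPolynomial.bind₁ ![MvPolynomial.X 2, MvPolynomial.X 3] G : MvPolynomial (Fin 4) ℝ)
      (MvPolynomial.bind₁ ![MvPolynomial.X 0, MvPolynomial.X 1] F)
    simpa [eval_bind₁_pair] using this
  · have := IsSemialgebraic.setOf_mul_rpow_lt (r := r) hs e
      (MvPolynomial.C (a * ε) * MvPolynomial.X 0 : MvPolynomial (Fin 4) ℝ) (MvPolynomial.X 3)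
    simpa only [map_mul, map_neg, MvPolynomial.eval_C, MvPolynomial.eval_X] using this
  · have := IsSemialgebraic.setOf_mul_rpow_lt (r := r) hs (φ.symm e)
      (MvPolynomial.C ε * MvPolynomial.X 0 : MvPolynomial (Fin 4) ℝ) (MvPolynomial.X 1)
    simpa only [map_mul, map_neg, MvPolynomial.eval_C, MvPolynomial.eval_X] using this
  · have := IsSemialgebraic.setOf_mul_rpow_lt (r := r) hs (-e)
      (MvPolynomial.C (a * ε) * MvPolynomial.X 0 : MvPolynomial (Fin 4) ℝ) (-MvPolynomial.X 3)
    simpa only [map_mul, map_neg, MvPolynomial.eval_C, MvPolynomial.eval_X] using this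
  · have := IsSemialgebraic.setOf_mul_rpow_lt (r := r) hs (-φ.symm e)
      (MvPolynomial.C ε * MvPolynomial.X 0 : MvPolynomial (Fin 4) ℝ) (-MvPolynomial.X 1)
    simpa only [map_mul, map_neg, MvPolynomial.eval_C, MvPolynomial.eval_X] using this

theorem evalAt_halfMap (hF : IsQuasihomogeneous β d F) (hG : IsQuasihomogeneous β d G)
    {ε a L : ℝ} (hε : ε = 1 ∨ ε = -1) (ha : 0 < a) {φ : ℝ ≃ ℝ}
    (hfg : ∀ t, a ^ d * (heightPoly ε G).eval (φ t) = (heightPoly ε F).eval t) {x : ℝ}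
    (hx : 0 < ε * x) (y : ℝ) :
    evalAt G (halfMap (β : ℝ) a φ L (x, y)).1 (halfMap (β : ℝ) a φ L (x, y)).2 =
      evalAt F x y := by
  have hεε : ε * ε = 1 := by rcases hε with rfl | rfl <;> norm_num
  have hax : 0 < ε * (a * x) := by
    have := mul_pos ha hx
    linarith
  have hX : 0 < (ε * x) ^ (β : ℝ) := Real.rpow_pos_of_pos hx _
  have hA : 0 < a ^ (β : ℝ) := Real.rpow_pos_of_pos ha _
  have hAX : (ε * (a * x)) ^ (β : ℝ) = a ^ (β : ℝ) * (ε * x) ^ (β : ℝ) := by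
    rw [← Real.mul_rpow ha.le hx.le]; congr 1; ring
  rw [halfMap_of_pos hε hx]
  simp only
  rw [hG.evalAt_eq hεε hax, hF.evalAt_eq hεε hx, hAX, ← mul_assoc (a ^ (β : ℝ)),
    mul_div_cancel_left₀ _ (mul_pos hA hX).ne', ← eval_heightPoly, ← eval_heightPoly, ← hfg]
  ring

/-- The glued map realises the equivalence of `F` and `G`. -/
theorem rSemialgLipschitzEquivalent_of_hasLinearEnds {r s : ℕ} (hs : 0 < s)
    (hβ : (β : ℝ) = (r : ℝ) / s) (hβ1 : 1 ≤ (β : ℝ))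
    (hF : IsQuasihomogeneous β d F) (hG : IsQuasihomogeneous β d G)
    {a₁ a₂ L₁ L₂ : ℝ} {φ₁ φ₂ : ℝ ≃ ℝ} (h₁ : HasLinearEnds φ₁ L₁) (h₂ : HasLinearEnds φ₂ L₂)
    (ha₁ : 0 < a₁) (ha₂ : 0 < a₂) (hL : a₁ ^ (β : ℝ) * L₁ = a₂ ^ (β : ℝ) * L₂)
    (hg₁ : 0 < (heightPoly 1 G).natDegree) (hg₂ : 0 < (heightPoly (-1) G).natDegree)
    (hfg₁ : ∀ t, a₁ ^ d * (heightPoly 1 G).eval (φ₁ t) = (heightPoly 1 F).eval t)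
    (hfg₂ : ∀ t, a₂ ^ d * (heightPoly (-1) G).eval (φ₂ t) = (heightPoly (-1) F).eval t) :
    RSemialgLipschitzEquivalent F G := by
  have hβ0 : (β : ℝ) ≠ 0 := by linarith
  set Φ := glueHomeo h₁ h₂ hβ1 ha₁ ha₂ hL with hΦ
  have hpos : ∀ p : ℝ × ℝ, 0 ≤ p.1 → Φ p = halfMap (β : ℝ) a₁ φ₁ L₁ p := fun p hp => if_pos hp
  have hneg : ∀ p : ℝ × ℝ, p.1 < 0 → Φ p = halfMap (β : ℝ) a₂ φ₂ L₂ p :=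
    fun p hp => if_neg (not_le.mpr hp)
  have hzero : ∀ y : ℝ, Φ (0, y) = (0, a₁ ^ (β : ℝ) * (L₁ * y)) := fun y => by
    rw [hpos _ le_rfl]
    simp [halfMap, Real.zero_rpow hβ0, perspective]
  have hsrc : Φ.source = {p | -1 < p.1 ∧ p.1 < 1} := rfl
  have htgt : Φ.target = {p | -a₂ < p.1 ∧ p.1 < a₁} := rfl
  have h0 : (0 : ℝ × ℝ) ∈ Φ.source := by rw [hsrc]; constructor <;> simp
  refine ⟨Φ, ⟨h0, ?_, ?_, ?_, ?_, ?_, ?_⟩, ?_⟩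
  · rw [← Prod.mk_zero_zero, hzero]; simp
  · have := (IsSemialgebraic.setOf_lt (MvPolynomial.C (-1)) (MvPolynomial.X (0 : Fin 2))).setOf_and
      (IsSemialgebraic.setOf_lt (MvPolynomial.X (0 : Fin 2)) (MvPolynomial.C 1))
    simpa [IsSemialgebraicPlane, hsrc] using this
  · have := (IsSemialgebraic.setOf_lt (MvPolynomial.C (-a₂))
      (MvPolynomial.X (0 : Fin 2))).setOf_and
      (IsSemialgebraic.setOf_lt (MvPolynomial.X (0 : Fin 2)) (MvPolynomial.C a₁))
    simpa [IsSemialgebraicPlane, htgt] using this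
  · have e₁ := (IsSemialgebraic.setOf_lt (MvPolynomial.C (-1))
      (MvPolynomial.X (0 : Fin 4))).setOf_and
      (IsSemialgebraic.setOf_lt (MvPolynomial.X (0 : Fin 4)) (MvPolynomial.C 1))
    have e₂ := IsSemialgebraic.setOf_halfMap_graph (L := L₁) hs hβ hF hG (Or.inl rfl) ha₁
      h₁.mono hg₁ hfg₁
    have e₃ := IsSemialgebraic.setOf_halfMap_graph (L := L₂) hs hβ hF hG (Or.inr rfl) ha₂
      h₂.mono hg₂ hfg₂
    have e₄ := (IsSemialgebraic.setOf_eq (MvPolynomial.X (0 : Fin 4)) 0).setOf_and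
      ((IsSemialgebraic.setOf_eq (MvPolynomial.X (2 : Fin 4)) 0).setOf_and
        (IsSemialgebraic.setOf_eq (MvPolynomial.X (3 : Fin 4))
          (MvPolynomial.C (a₁ ^ (β : ℝ) * L₁) * MvPolynomial.X 1)))
    have e := e₁.setOf_and (e₂.setOf_or (e₃.setOf_or e₄))
    unfold HasSemialgebraicGraphOn
    convert e using 3 with v
    refine and_congr (by simp [hsrc]) ?_
    simp only [one_mul, neg_one_mul, Left.neg_pos_iff, MvPolynomial.eval_X, map_zero, map_mul,
      MvPolynomial.eval_C]
    rcases lt_trichotomy (v 0) 0 with hv | hv | hv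
    · simp [hv, hv.ne, hv.not_gt, hneg (v 0, v 1) hv]
    · simp [hv, hzero, mul_assoc]
    · simp [hv, hv.ne', hv.not_gt, hpos (v 0, v 1) hv.le]
  · obtain ⟨K, hK⟩ := exists_lipschitzOnWith_glueMap h₁ h₂ hβ1 ha₁ ha₂ hL 1
    exact ⟨K, hK.mono fun p hp => abs_le.mpr ⟨hp.1.le, hp.2.le⟩⟩
  · obtain ⟨K, hK⟩ := exists_lipschitzOnWith_glueMap h₁.symm h₂.symm hβ1 (inv_pos.mpr ha₁)
      (inv_pos.mpr ha₂) (by simp only [Real.inv_rpow ha₁.le, Real.inv_rpow ha₂.le, ← mul_inv, hL])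
      (max a₁ a₂)
    refine ⟨K, hK.mono fun p hp => abs_le.mpr ⟨?_, hp.2.le.trans (le_max_left _ _)⟩⟩
    have := le_max_right a₁ a₂
    linarith [hp.1]
  · filter_upwards [Φ.open_source.mem_nhds h0] with p hp
    have hpos' : ∀ x y : ℝ, 0 < x → evalAt G (Φ (x, y)).1 (Φ (x, y)).2 = evalAt F x y :=
      fun x y hx => by
        rw [hpos _ hx.le]
        exact evalAt_halfMap hF hG (Or.inl rfl) ha₁ hfg₁ (by simpa using hx) y
    obtain ⟨x, y⟩ := p
    rcases lt_trichotomy x 0 with hx | rfl | hx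
    · rw [hneg _ hx]
      exact evalAt_halfMap hF hG (Or.inr rfl) ha₂ hfg₂ (by simpa using hx) y
    -- On the axis the identity follows by continuity from x > 0.
    · have hu : Tendsto (fun u : ℝ => (u, y)) (𝓝[>] 0) (𝓝 (0, y)) :=
        (Continuous.tendsto' (by fun_prop) _ _ rfl).mono_left nhdsWithin_le_nhds
      have hl := ((continuous_evalAt G).tendsto _).comp ((Φ.continuousAt hp).tendsto.comp hu)
      have hr := ((continuous_evalAt F).tendsto _).comp hu
      refine tendsto_nhds_unique hl (hr.congr' ?_)
      filter_upwards [self_mem_nhdsWithin] with u hu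
      exact (hpos' u y hu).symm
    · exact hpos' x y hx

/-- The reflection `(x, y) ↦ (σ x, δ y)` for signs `σ`, `δ`. -/
noncomputable def signHomeo {σ δ : ℝ} (hσ : σ * σ = 1) (hδ : δ * δ = 1) : ℝ × ℝ ≃ₜ ℝ × ℝ where
  toFun p := (σ * p.1, δ * p.2)
  invFun p := (σ * p.1, δ * p.2)
  left_inv p := by simp [← mul_assoc, hσ, hδ]
  right_inv p := by simp [← mul_assoc, hσ, hδ]
  continuous_toFun := by fun_prop
  continuous_invFun := by fun_prop

theorem lipschitzWith_signHomeo {σ δ : ℝ} (hσ : σ * σ = 1) (hδ : δ * δ = 1) :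
    LipschitzWith 1 (signHomeo hσ hδ) := by
  have hσ' : |σ| = 1 := by rcases mul_self_eq_one_iff.mp hσ with rfl | rfl <;> simp
  have hδ' : |δ| = 1 := by rcases mul_self_eq_one_iff.mp hδ with rfl | rfl <;> simp
  refine LipschitzWith.of_dist_le_mul fun p q => ?_
  simp [signHomeo, Prod.dist_eq, Real.dist_eq, ← mul_sub, abs_mul, hσ', hδ']

theorem RSemialgLipschitzEquivalent.of_signs {σ δ : ℝ} (hσ : σ * σ = 1) (hδ : δ * δ = 1)
    {G' : MvPolynomial (Fin 2) ℝ} (hG' : ∀ x y, evalAt G' x y = evalAt G (σ * x) (δ * y))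
    (h : RSemialgLipschitzEquivalent F G') : RSemialgLipschitzEquivalent F G := by
  obtain ⟨Φ, hΦ, hFG⟩ := h
  have hR := lipschitzWith_signHomeo hσ hδ
  obtain ⟨K, hK⟩ := hΦ.lipschitz
  obtain ⟨K', hK'⟩ := hΦ.lipschitz_symm
  open MvPolynomial in
  refine ⟨Φ.transHomeomorph (signHomeo hσ hδ), ⟨hΦ.zero_mem, ?_, hΦ.semialgebraic_source, ?_, ?_,
    ⟨_, hR.comp_lipschitzOnWith hK⟩,
    ⟨_, hK'.comp (hR.lipschitzOnWith (s := (signHomeo hσ hδ) ⁻¹' Φ.target)) fun p hp => hp⟩⟩, ?_⟩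
  · simp [hΦ.map_zero, signHomeo]
  · have := hΦ.semialgebraic_target.preimage
      ![C σ * X (0 : Fin 2), C δ * X (1 : Fin 2)]
    unfold IsSemialgebraicPlane
    convert this using 3 with v
    simp [signHomeo, Homeomorph.symm]
  · have := hΦ.semialgebraic_graph.preimage
      ![X (0 : Fin 4), X (1 : Fin 4), C σ * X (2 : Fin 4), C δ * X (3 : Fin 4)]
    unfold HasSemialgebraicGraphOn
    convert this using 3 with v
    -- The reflection is an involution, so it can be moved to the other side of the graph equation.
    have : (v 2, v 3) = signHomeo hσ hδ (Φ (v 0, v 1)) ↔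
        signHomeo hσ hδ (v 2, v 3) = Φ (v 0, v 1) := by
      rw [← (signHomeo hσ hδ).symm_apply_eq]; rfl
    simp [this]
    simp [signHomeo]
  · filter_upwards [hFG] with p hp
    rw [← hp, hG']
    rfl

end Germ

/-! ### Monomials and height functions of quasihomogeneous polynomials. -/

section Quasihomogeneous

open MvPolynomial

variable {β : ℚ} {r s d : ℕ} {F G : MvPolynomial (Fin 2) ℝ}

theorem evalAt_eq_sum (F : MvPolynomial (Fin 2) ℝ) (x y : ℝ) :
    evalAt F x y = ∑ m ∈ F.support, F.coeff m * (x ^ m 0 * y ^ m 1) := by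
  simp [evalAt, eval_eq', Fin.prod_univ_two]

theorem IsQuasihomogeneous.weight_eq (hs : 0 < s) (hβ : (β : ℝ) = (r : ℝ) / s)
    (hF : IsQuasihomogeneous β d F) {m : Fin 2 →₀ ℕ} (hm : m ∈ F.support) :
    s * m 0 + r * m 1 = s * d := by
  have hQ : ∑ m ∈ F.support, monomial m
      (F.coeff m * ((2 : ℝ) ^ (s * m 0 + r * m 1) - 2 ^ (s * d))) = 0 := by
    refine MvPolynomial.funext fun v => ?_
    -- For t = 2^s both t and t^β = 2^r are integer powers of 2, so comparing coefficients gives the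
    -- weight relation.
    have h1 := hF (2 ^ s) (by positivity) (v 0) (v 1)
    have h2 : ((2 : ℝ) ^ s) ^ (β : ℝ) = 2 ^ r := by
      rw [← Real.rpow_natCast, ← Real.rpow_mul (by norm_num), hβ,
        mul_div_cancel₀ _ (by exact_mod_cast hs.ne'), Real.rpow_natCast]
    rw [h2, evalAt_eq_sum, evalAt_eq_sum, ← sub_eq_zero, Finset.mul_sum,
      ← Finset.sum_sub_distrib] at h1
    rw [map_zero, map_sum, ← h1]
    refine Finset.sum_congr rfl fun m _ => ?_
    rw [eval_monomial, Finsupp.prod_fintype _ _ (by simp), Fin.prod_univ_two]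
    ring
  have h3 := congrArg (coeff m) hQ
  simp only [coeff_sum, coeff_monomial, Finset.sum_ite_eq', hm, if_true, coeff_zero] at h3
  have h4 := (mul_eq_zero.mp h3).resolve_left (mem_support_iff.mp hm)
  exact Nat.pow_right_injective le_rfl (by exact_mod_cast sub_eq_zero.mp h4)

/-- The weight relation permits scaling with t^(1/s) replaced by -1. For s odd this links the left
and right height functions; for s even and r odd it says that `F` is even in y. -/
theorem IsQuasihomogeneous.evalAt_neg_one_pow (hs : 0 < s) (hβ : (β : ℝ) = (r : ℝ) / s)
    (hF : IsQuasihomogeneous β d F) (x y : ℝ) :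
    evalAt F ((-1) ^ s * x) ((-1) ^ r * y) = (-1) ^ (s * d) * evalAt F x y := by
  rw [evalAt_eq_sum, evalAt_eq_sum, Finset.mul_sum]
  refine Finset.sum_congr rfl fun m hm => ?_
  rw [← hF.weight_eq hs hβ hm, mul_pow, mul_pow, ← pow_mul, ← pow_mul, pow_add]
  ring

theorem coeff_heightPoly (ε : ℝ) (F : MvPolynomial (Fin 2) ℝ) (n : ℕ) :
    (heightPoly ε F).coeff n =
      ∑ m ∈ F.support, if n = m 1 then F.coeff m * ε ^ m 0 else 0 := by
  have h : heightPoly ε F =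
      ∑ m ∈ F.support, Polynomial.C (F.coeff m * ε ^ m 0) * Polynomial.X ^ m 1 := by
    refine Polynomial.funext fun t => ?_
    rw [eval_heightPoly, evalAt_eq_sum, Polynomial.eval_finsetSum]
    refine Finset.sum_congr rfl fun m _ => ?_
    simp [mul_assoc]
  rw [h, Polynomial.finsetSum_coeff]
  simp only [Polynomial.coeff_C_mul_X_pow]

/-- By the weight relation the Y-exponent determines the X-exponent, so no two monomials merge when
x is set to ε. -/
theorem IsQuasihomogeneous.coeff_heightPoly_of_mem (hs : 0 < s) (hβ : (β : ℝ) = (r : ℝ) / s)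
    (hF : IsQuasihomogeneous β d F) (ε : ℝ) {m : Fin 2 →₀ ℕ} (hm : m ∈ F.support) :
    (heightPoly ε F).coeff (m 1) = F.coeff m * ε ^ m 0 := by
  rw [coeff_heightPoly, Finset.sum_eq_single_of_mem m hm, if_pos rfl]
  intro m' hm' hne
  refine if_neg fun h1 => hne ?_
  have e := hF.weight_eq hs hβ hm
  have e' := hF.weight_eq hs hβ hm'
  rw [← h1, ← e] at e'
  have h0 : m' 0 = m 0 := Nat.eq_of_mul_eq_mul_left hs (by omega)
  ext i
  fin_cases i
  · exact h0
  · exact h1.symm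

theorem IsQuasihomogeneous.abs_coeff_heightPoly (hs : 0 < s) (hβ : (β : ℝ) = (r : ℝ) / s)
    (hF : IsQuasihomogeneous β d F) (n : ℕ) :
    |(heightPoly (-1) F).coeff n| = |(heightPoly 1 F).coeff n| := by
  by_cases h : ∃ m ∈ F.support, n = m 1
  · obtain ⟨m, hm, rfl⟩ := h
    rw [hF.coeff_heightPoly_of_mem hs hβ _ hm, hF.coeff_heightPoly_of_mem hs hβ _ hm]
    simp [abs_mul]
  · push Not at h
    rw [coeff_heightPoly, coeff_heightPoly, Finset.sum_eq_zero, Finset.sum_eq_zero]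
    · exact fun m hm => if_neg (h m hm)
    · exact fun m hm => if_neg (h m hm)

theorem IsQuasihomogeneous.natDegree_heightPoly (hs : 0 < s) (hβ : (β : ℝ) = (r : ℝ) / s)
    (hF : IsQuasihomogeneous β d F) :
    (heightPoly (-1) F).natDegree = (heightPoly 1 F).natDegree := by
  have h : ∀ n, (heightPoly (-1) F).coeff n = 0 ↔ (heightPoly 1 F).coeff n = 0 := fun n => by
    rw [← abs_eq_zero, hF.abs_coeff_heightPoly hs hβ, abs_eq_zero]
  refine le_antisymm ?_ ?_ <;> rw [Polynomial.natDegree_le_iff_coeff_eq_zero] <;> intro n hn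
  · exact (h n).mpr (Polynomial.coeff_eq_zero_of_natDegree_lt hn)
  · exact (h n).mp (Polynomial.coeff_eq_zero_of_natDegree_lt hn)

theorem IsQuasihomogeneous.abs_leadingCoeff_heightPoly (hs : 0 < s)
    (hβ : (β : ℝ) = (r : ℝ) / s) (hF : IsQuasihomogeneous β d F) :
    |(heightPoly (-1) F).leadingCoeff| = |(heightPoly 1 F).leadingCoeff| := by
  rw [Polynomial.leadingCoeff, Polynomial.leadingCoeff, hF.natDegree_heightPoly hs hβ,
    hF.abs_coeff_heightPoly hs hβ]

theorem IsQuasihomogeneous.natDegree_heightPoly_pos (hs : 0 < s)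
    (hβ : (β : ℝ) = (r : ℝ) / s) (hF : IsQuasihomogeneous β d F)
    (hFX : ∀ c : ℝ, F ≠ C c * X 0 ^ d) : 0 < (heightPoly 1 F).natDegree := by
  by_contra! h0
  refine hFX (F.coeff (Finsupp.single 0 d)) ?_
  ext m
  rw [coeff_C_mul, coeff_X_pow]
  split_ifs with hm
  · rw [← hm, mul_one]
  · rw [mul_zero]
    by_contra hne
    have hmem := mem_support_iff.mpr hne
    have h1 : (heightPoly 1 F).coeff (m 1) ≠ 0 := by
      rw [hF.coeff_heightPoly_of_mem hs hβ _ hmem]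
      simpa using hne
    have h2 : m 1 = 0 := by
      have := Polynomial.le_natDegree_of_ne_zero h1
      omega
    have h3 := hF.weight_eq hs hβ hmem
    rw [h2, mul_zero, add_zero] at h3
    refine hm ?_
    ext i
    fin_cases i
    · simpa using (Nat.eq_of_mul_eq_mul_left hs h3).symm
    · simpa using h2.symm

/-- Some monomial is a pure power of Y, and the weight relation makes its Y-exponent the largest
possible. -/
theorem IsQuasihomogeneous.natDegree_heightPoly_of_not_dvd (hs : 0 < s) (hr : 0 < r)
    (hβ : (β : ℝ) = (r : ℝ) / s) (hF : IsQuasihomogeneous β d F)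
    (hX : ¬ (X 0 : MvPolynomial (Fin 2) ℝ) ∣ F) :
    r * (heightPoly 1 F).natDegree = s * d := by
  obtain ⟨m, hm, hm0⟩ : ∃ m ∈ F.support, m 0 = 0 := by
    by_contra! h
    refine hX ?_
    rw [← F.support_sum_monomial_coeff]
    exact Finset.dvd_sum fun m hm => X_dvd_monomial.mpr (Or.inr (h m hm))
  have h1 := hF.weight_eq hs hβ hm
  rw [hm0, mul_zero, zero_add] at h1
  rw [← h1]
  congr 1
  refine le_antisymm ?_ (Polynomial.le_natDegree_of_ne_zero ?_)
  · rw [Polynomial.natDegree_le_iff_coeff_eq_zero]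
    intro n hn
    rw [coeff_heightPoly]
    refine Finset.sum_eq_zero fun m' hm' => if_neg ?_
    rintro rfl
    have h2 := hF.weight_eq hs hβ hm'
    have h3 := Nat.mul_lt_mul_of_pos_left hn hr
    omega
  · rw [hF.coeff_heightPoly_of_mem hs hβ _ hm]
    simpa using mem_support_iff.mp hm

theorem IsQuasihomogeneous.exists_signs (hG : IsQuasihomogeneous β d G) (σ δ : ℝ) :
    ∃ G', IsQuasihomogeneous β d G' ∧ ∀ x y, evalAt G' x y = evalAt G (σ * x) (δ * y) := by
  have h : ∀ x y, evalAt (bind₁ ![C σ * X 0, C δ * X 1] G) x y =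
      evalAt G (σ * x) (δ * y) := fun x y => by
    rw [evalAt, eval_bind₁_pair]
    simp
  refine ⟨_, fun t ht x y => ?_, h⟩
  rw [h, h, ← hG t ht, mul_left_comm, mul_left_comm δ]

end Quasihomogeneous

/-! ### Matching the slopes on the axis, and reduction to increasing diffeomorphisms. -/

section Main

variable {β : ℚ} {r s d : ℕ} {F G : MvPolynomial (Fin 2) ℝ}

/-- When βm = d, a^β = (a^d)^(1/m) cancels the factor a^d inside `endSlope`. The result is free of
a, which allows gluing with a₁ ≠ a₂. -/
theorem rpow_mul_endSlope {f g : Polynomial ℝ} {a : ℝ} (ha : 0 < a) (hf : 0 < f.natDegree)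
    (hβ : (β : ℝ) * f.natDegree = d) :
    a ^ (β : ℝ) * endSlope (a ^ d) g f =
      (|f.leadingCoeff| / |g.leadingCoeff|) ^ ((f.natDegree : ℝ)⁻¹) := by
  have hm : (f.natDegree : ℝ) ≠ 0 := by exact_mod_cast hf.ne'
  have h1 : a ^ (β : ℝ) = (a ^ d) ^ ((f.natDegree : ℝ)⁻¹) := by
    rw [← Real.rpow_natCast, ← Real.rpow_mul ha.le, ← hβ, mul_inv_cancel_right₀ hm]
  have h2 : 0 < a ^ d := pow_pos ha d
  rw [endSlope, h1, ← Real.mul_rpow h2.le (by positivity), abs_of_pos h2]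
  congr 1
  field_simp

theorem rSemialgLipschitzEquivalent_of_mono (hs : 0 < s) (hsr : s < r)
    (hβ : (β : ℝ) = (r : ℝ) / s) (hF : IsQuasihomogeneous β d F)
    (hG : IsQuasihomogeneous β d G)
    (hFX : ∀ c : ℝ, F ≠ MvPolynomial.C c * MvPolynomial.X 0 ^ d)
    {a₁ a₂ : ℝ} {φ₁ φ₂ : ℝ ≃ ℝ} (h₁ : IsMonoBiLipschitz φ₁) (h₂ : IsMonoBiLipschitz φ₂)
    (ha₁ : 0 < a₁) (ha₂ : 0 < a₂)
    (hfg₁ : ∀ t, a₁ ^ d * evalAt G 1 (φ₁ t) = evalAt F 1 t)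
    (hfg₂ : ∀ t, a₂ ^ d * evalAt G (-1) (φ₂ t) = evalAt F (-1) t)
    (h : a₁ = a₂ ∨ ¬ (MvPolynomial.X 0 : MvPolynomial (Fin 2) ℝ) ∣ F) :
    RSemialgLipschitzEquivalent F G := by
  simp only [← eval_heightPoly] at hfg₁ hfg₂
  have hs0 : (0 : ℝ) < s := by exact_mod_cast hs
  have hf₁ := hF.natDegree_heightPoly_pos hs hβ hFX
  have hdeg := hF.natDegree_heightPoly hs hβ
  have hf₂ : 0 < (heightPoly (-1) F).natDegree := by rwa [hdeg]
  have hlF := hF.abs_leadingCoeff_heightPoly hs hβ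
  have hlG := hG.abs_leadingCoeff_heightPoly hs hβ
  refine rSemialgLipschitzEquivalent_of_hasLinearEnds hs hβ ?_ hF hG
    (h₁.hasLinearEnds (pow_pos ha₁ d).ne' hf₁ hfg₁)
    (h₂.hasLinearEnds (pow_pos ha₂ d).ne' hf₂ hfg₂) ha₁ ha₂ ?_
    (natDegree_pos_of_intertwine hf₁ hfg₁) (natDegree_pos_of_intertwine hf₂ hfg₂) hfg₁ hfg₂
  · rw [hβ, le_div_iff₀ hs0, one_mul]
    exact_mod_cast hsr.le
  · rcases h with rfl | hX
    · rw [endSlope, endSlope, hdeg, hlF, hlG]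
    · have hd := hF.natDegree_heightPoly_of_not_dvd hs (hs.trans hsr) hβ hX
      have hd' : (β : ℝ) * (heightPoly 1 F).natDegree = d := by
        rw [hβ, div_mul_eq_mul_div, div_eq_iff hs0.ne', mul_comm (d : ℝ)]
        exact_mod_cast hd
      rw [rpow_mul_endSlope ha₁ hf₁ hd', rpow_mul_endSlope ha₂ hf₂ (by rwa [hdeg]), hdeg, hlF,
        hlG]

/-- Multiplication by a sign, as a permutation of the line. -/
noncomputable def signEquiv {δ : ℝ} (hδ : δ * δ = 1) : ℝ ≃ ℝ where
  toFun t := δ * t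
  invFun t := δ * t
  left_inv t := by simp [← mul_assoc, hδ]
  right_inv t := by simp [← mul_assoc, hδ]

theorem lipschitzWith_signEquiv {δ : ℝ} (hδ : δ * δ = 1) : LipschitzWith 1 (signEquiv hδ) := by
  have hδ' : |δ| = 1 := by rcases mul_self_eq_one_iff.mp hδ with rfl | rfl <;> simp
  refine LipschitzWith.of_dist_le_mul fun p q => ?_
  simp [signEquiv, Real.dist_eq, ← mul_sub, abs_mul, hδ']

theorem contDiff_signEquiv {δ : ℝ} (hδ : δ * δ = 1) : ContDiff ℝ 1 (signEquiv hδ) :=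
  contDiff_const.mul contDiff_id

theorem IsBiLipschitzNash.exists_sign {φ : ℝ ≃ ℝ} (h : IsBiLipschitzNash φ) :
    ∃ δ : ℝ, δ * δ = 1 ∧ ∃ ψ : ℝ ≃ ℝ, IsMonoBiLipschitz ψ ∧ ∀ t, φ t = δ * ψ t := by
  obtain ⟨δ, hδ, hmono⟩ : ∃ δ : ℝ, δ * δ = 1 ∧ StrictMono fun t => δ * φ t := by
    rcases h.contDiff.continuous.strictMono_of_inj φ.injective with hm | hm
    · exact ⟨1, by norm_num, by simpa using hm⟩
    · exact ⟨-1, by norm_num, fun a b hab => by simpa using hm hab⟩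
  obtain ⟨K, hK⟩ := h.lipschitz
  obtain ⟨K', hK'⟩ := h.lipschitz_symm
  have hle : (1 : WithTop ℕ∞) ≤ ∞ := by exact_mod_cast le_top
  refine ⟨δ, hδ, φ.trans (signEquiv hδ), ⟨hmono, (contDiff_signEquiv hδ).comp
    (h.contDiff.of_le hle), (h.contDiff_symm.of_le hle).comp (contDiff_signEquiv hδ),
    ⟨_, (lipschitzWith_signEquiv hδ).comp hK⟩, ⟨_, hK'.comp (lipschitzWith_signEquiv hδ)⟩⟩,
    fun t => ?_⟩
  simp [signEquiv, ← mul_assoc, hδ]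

theorem IsMonoBiLipschitz.conj_sign {φ : ℝ ≃ ℝ} (h : IsMonoBiLipschitz φ) {δ : ℝ}
    (hδ : δ * δ = 1) :
    IsMonoBiLipschitz ((signEquiv hδ).trans (φ.trans (signEquiv hδ))) := by
  obtain ⟨K, hK⟩ := h.lipschitz
  obtain ⟨K', hK'⟩ := h.lipschitz_symm
  have hc := contDiff_signEquiv hδ
  have hl := lipschitzWith_signEquiv hδ
  refine ⟨fun a b hab => ?_, hc.comp (h.contDiff.comp hc), hc.comp (h.contDiff_symm.comp hc),
    ⟨_, hl.comp (hK.comp hl)⟩, ⟨_, hl.comp (hK'.comp hl)⟩⟩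
  rcases mul_self_eq_one_iff.mp hδ with rfl | rfl
  · simpa [signEquiv] using h.strictMono hab
  · simpa [signEquiv] using h.strictMono (neg_lt_neg hab)

/-- The sign σ records whether the half-planes are exchanged, so that both cases of the action are
treated at once. -/
theorem ProtoTransition.exists_sign (T : ProtoTransition)
    (hT : T.act d (rightHeight G, leftHeight G) = (rightHeight F, leftHeight F)) :
    0 < |T.lam₁| ∧ 0 < |T.lam₂| ∧ ∃ σ : ℝ, σ * σ = 1 ∧
      (∀ t, |T.lam₁| ^ d * evalAt G σ (T.phi₁ t) = evalAt F 1 t) ∧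
      ∀ t, |T.lam₂| ^ d * evalAt G (-σ) (T.phi₂ t) = evalAt F (-1) t := by
  refine ⟨abs_pos.mpr (left_ne_zero_of_mul T.mul_pos.ne'),
    abs_pos.mpr (right_ne_zero_of_mul T.mul_pos.ne'), ?_⟩
  unfold ProtoTransition.act at hT
  split_ifs at hT
  · exact ⟨1, by norm_num, fun t => congrFun (congrArg Prod.fst hT) t,
      fun t => congrFun (congrArg Prod.snd hT) t⟩
  · refine ⟨-1, by norm_num, fun t => congrFun (congrArg Prod.fst hT) t, fun t => ?_⟩
    rw [neg_neg]
    exact congrFun (congrArg Prod.snd hT) t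

end Main

end SemialgLip

theorem mainTheorem2 (β : ℚ) (r s : ℕ) (hs : 0 < s) (hsr : s < r) (hrs : Nat.Coprime r s)
    (hβ : β = (r : ℚ) / (s : ℚ)) (d : ℕ) (hd : 1 ≤ d) (F G : MvPolynomial (Fin 2) ℝ)
    (hF : SemialgLip.IsQuasihomogeneous β d F) (hG : SemialgLip.IsQuasihomogeneous β d G)
    (hFX : ∀ c : ℝ, F ≠ MvPolynomial.C c * MvPolynomial.X 0 ^ d)
    (hGX : ∀ c : ℝ, G ≠ MvPolynomial.C c * MvPolynomial.X 0 ^ d)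
    (T : SemialgLip.ProtoTransition)
    (hT : SemialgLip.ProtoTransition.act d
        (SemialgLip.rightHeight G, SemialgLip.leftHeight G) T =
      (SemialgLip.rightHeight F, SemialgLip.leftHeight F))
    (h : (Even r ∨ Odd s) ∨ T.lam₁ = T.lam₂ ∨
      (¬ (MvPolynomial.X 0 : MvPolynomial (Fin 2) ℝ) ∣ F ∧
        ¬ (MvPolynomial.X 0 : MvPolynomial (Fin 2) ℝ) ∣ G)) :
    SemialgLip.RSemialgLipschitzEquivalent F G := by
  have hβ' : (β : ℝ) = (r : ℝ) / s := by rw [hβ]; push_cast; rfl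
  obtain ⟨ha₁, ha₂, σ, hσ, hfg₁, hfg₂⟩ := T.exists_sign hT
  obtain ⟨δ₁, hδ₁, ψ₁, hψ₁, hφ₁⟩ := T.nash₁.exists_sign
  obtain ⟨δ₂, hδ₂, ψ₂, hψ₂, hφ₂⟩ := T.nash₂.exists_sign
  simp only [hφ₁] at hfg₁
  simp only [hφ₂] at hfg₂
  -- By coprimality r even forces s odd, so condition (a) amounts to s odd.
  rcases Nat.even_or_odd s with hse | hso
  · have hro : Odd r := by
      rw [← Nat.not_even_iff_odd]
      exact fun hre => Nat.not_coprime_of_dvd_of_dvd one_lt_two hre.two_dvd hse.two_dvd hrs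
    have hcond : |T.lam₁| = |T.lam₂| ∨ ¬ (MvPolynomial.X 0 : MvPolynomial (Fin 2) ℝ) ∣ F := by
      rcases h with (hr | hs') | hl | hX
      · exact absurd hr (Nat.not_even_iff_odd.mpr hro)
      · exact absurd hse (Nat.not_even_iff_odd.mpr hs')
      · exact Or.inl (congrArg _ hl)
      · exact Or.inr hX.1
    -- Here `G` is even in y, so the orientations of φ₁ and φ₂ can be dropped independently.
    have heven : ∀ δ : ℝ, δ * δ = 1 → ∀ x y,
        SemialgLip.evalAt G x (δ * y) = SemialgLip.evalAt G x y := fun δ hδ x y => by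
      have := hG.evalAt_neg_one_pow hs hβ' x y
      rw [hse.neg_one_pow, hro.neg_one_pow, (hse.mul_right d).neg_one_pow, one_mul, one_mul] at this
      rcases mul_self_eq_one_iff.mp hδ with rfl | rfl
      · rw [one_mul]
      · exact this
    simp only [heven δ₁ hδ₁] at hfg₁
    simp only [heven δ₂ hδ₂] at hfg₂
    obtain ⟨G', hG', hGG'⟩ := hG.exists_signs σ 1
    refine SemialgLip.RSemialgLipschitzEquivalent.of_signs hσ (one_mul 1) hGG'
      (SemialgLip.rSemialgLipschitzEquivalent_of_mono hs hsr hβ' hF hG' hFX hψ₁ hψ₂ ha₁ ha₂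
        (fun t => ?_) (fun t => ?_) hcond)
    · rw [hGG', mul_one, one_mul, hfg₁]
    · rw [hGG', mul_neg_one, one_mul, hfg₂]
  -- For s odd only λ₁ and φ₁ are kept: the left half uses the same factor |λ₁| and the conjugate of
  -- ψ₁ by t ↦ (-1)^r t, so the slopes match automatically.
  · obtain ⟨G', hG', hGG'⟩ := hG.exists_signs σ δ₁
    have hρ : ((-1 : ℝ) ^ r) * (-1) ^ r = 1 := by rw [← mul_pow]; norm_num
    have hG1 : ∀ t, |T.lam₁| ^ d * SemialgLip.evalAt G' 1 (ψ₁ t) = SemialgLip.evalAt F 1 t :=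
      fun t => by rw [hGG', mul_one, hfg₁]
    refine SemialgLip.RSemialgLipschitzEquivalent.of_signs hσ hδ₁ hGG'
      (SemialgLip.rSemialgLipschitzEquivalent_of_mono hs hsr hβ' hF hG' hFX hψ₁
        (hψ₁.conj_sign hρ) ha₁ ha₁ hG1 (fun t => ?_) (Or.inl rfl))
    have h1 := hG'.evalAt_neg_one_pow hs hβ' 1 (ψ₁ ((-1) ^ r * t))
    have h2 := hF.evalAt_neg_one_pow hs hβ' 1 ((-1) ^ r * t)
    rw [hso.neg_one_pow, mul_one] at h1 h2
    rw [← mul_assoc, hρ, one_mul] at h2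
    rw [h2, ← hG1]
    change |T.lam₁| ^ d * SemialgLip.evalAt G' (-1) ((-1) ^ r * ψ₁ ((-1) ^ r * t)) = _
    rw [h1]
    ring
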